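/- Let $G$ be a compact connected Lie group with Lie algebra $\mathfrak g$, acting smoothly on a symplectic manifold $(M,\omega)$ (smooth, finite-dimensional, Hausdorff, second countable, without boundary). For $\xi\in\mathfrak g$ let $\xi_M(x)=\frac{d}{dt}\big|_{t=0}\exp(t\xi)\cdot x$ be the infinitesimal generator. Let $(\omega,g,\mathbf J)$ be a $G$-invariant compatible triple, i.e. $g$ is a Riemannian metric and $\mathbf J$ an almost complex structure on $M$ with $g(\cdot,\cdot)=\omega(\cdot,\mathbf J\,\cdot)$, and $G$ preserves $\omega$, $g$ and $\mathbf J$. Let $d\lambda=f\,dV_g$ be a $G$-invariant measure on $M$, where $dV_g$ is the Riemannian measure of $g$ and $f\ge 0$ is a smooth bounded function. Write $L^2_\lambda$ for square integrability with respect to $\lambda$ of functions, and of vector fields and 1-forms via their pointwise $g$-norms, and write $\langle\alpha,\beta\rangle_{L^2_\lambda}=\int_M\langle\!\langle\alpha,\beta\rangle\!\rangle\,d\lambda$, where $\langle\!\langle\cdot,\cdot\rangle\!\rangle$ is the pointwise inner product of 1-forms given by $g$. A smooth 1-form $\alpha\in L^2_\lambda$ is called $\lambda$-harmonic if $d\alpha=0$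 and $\delta_\lambda\alpha=0$, where $\delta_\lambda$ is the formal adjoint of $d$ with respect to $\lambda$; that is, $\delta_\lambda\alpha=0$ means $\int_M\langle\!\langle\alpha,d\varphi\rangle\!\rangle\,d\lambda=0$ for all $\varphi\in C_c^\infty(M)$. Assume that 1. $\|\xi_M\|_{L^2_\lambda}<\infty$ for all $\xi\in\mathfrak g$; 2. every smooth closed 1-form $\alpha\in L^2_\lambda$ can be written as an $L^2_\lambda$-orthogonal sum $\alpha=dh+\chi$, where $h$ is a smooth function, $h,dh\in L^2_\lambda$, and $\chi\in L^2_\lambda$ is a $\lambda$-harmonic 1-form; 3. each de Rham cohomology class in $H^1(M,\mathbb R)$ contains exactly one $\lambda$-harmonic 1-form in $L^2_\lambda$; 4. $\mathbf J$ preserves the space of $\lambda$-harmonic 1-forms in $L^2_\lambda$, where $(\mathbf J\alpha)(v)=\alpha(\mathbf Jv)$; 5. every connected component of $M$ contains a point fixed by $G$. Then the action is Hamiltonian: there is a smooth map $\mu\colon M\to\mathfrak g^*$ which is equivariant for the coadjoint action, i.e. $\langle\mu(a\cdot x),\mathrm{Ad}_a\xi\rangle=\langle\mu(x),\xi\rangle$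 for all $a\in G$, $x\in M$, $\xi\in\mathfrak g$, and which satisfies $\omega(\xi_M,\cdot)=d\langle\mu,\xi\rangle$ for all $\xi\in\mathfrak g$. -/

import Mathlib

open MeasureTheory Set
open scoped Manifold ContDiff

noncomputable section

namespace HamAct

section Forms

variable {n : ℕ} {M : Type*} [TopologicalSpace M] [ChartedSpace (EuclideanSpace ℝ (Fin n)) M]

/-- Not necessarily smooth differential `k`-forms on an `n`-manifold `M`: a family of
alternating `k`-linear forms on the tangent spaces. -/
abbrev DiffForm (n : ℕ) (M : Type*) [TopologicalSpace M]
    [ChartedSpace (EuclideanSpace ℝ (Fin n)) M] (k : ℕ) : Type _ :=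
  ∀ x : M, TangentSpace (𝓡 n) x [⋀^Fin k]→L[ℝ] ℝ

/-- Not necessarily smooth fields of covectors on `M`; these are the 1-forms on `M`. -/
abbrev OneForm (n : ℕ) (M : Type*) [TopologicalSpace M]
    [ChartedSpace (EuclideanSpace ℝ (Fin n)) M] : Type _ :=
  ∀ x : M, TangentSpace (𝓡 n) x →L[ℝ] ℝ

/-- The coordinate expression of a form `α` in the chart `e` of `M`, i.e. the pullback of `α` under
the inverse of `e`. It is meaningful on `e.target`. -/
def DiffForm.inChart {k : ℕ} (α : DiffForm n M k)
    (e : OpenPartialHomeomorph M (EuclideanSpace ℝ (Fin n))) (y : EuclideanSpace ℝ (Fin n)) :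
    EuclideanSpace ℝ (Fin n) [⋀^Fin k]→L[ℝ] ℝ :=
  (α (e.symm y)).compContinuousLinearMap (mfderiv (𝓡 n) (𝓡 n) e.symm y)

/-- A form is smooth if its coordinate expressions are. -/
def DiffForm.IsSmooth {k : ℕ} (α : DiffForm n M k) : Prop :=
  ∀ x : M, ContDiffOn ℝ ∞ (α.inChart (chartAt _ x)) (chartAt (EuclideanSpace ℝ (Fin n)) x).target

/-- A form `α` is closed, `dα = 0`, if the exterior derivatives of its coordinate expressions
vanish. (To be used for smooth forms.) -/
def DiffForm.IsClosed {k : ℕ} (α : DiffForm n M k) : Prop :=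
  ∀ x : M, ∀ y ∈ (chartAt (EuclideanSpace ℝ (Fin n)) x).target,
    extDeriv (α.inChart (chartAt _ x)) y = 0

/-- A covector field, seen as an alternating form of degree one. -/
def OneForm.toDiffForm (α : OneForm n M) : DiffForm n M 1 :=
  fun x => ContinuousAlternatingMap.ofSubsingleton ℝ (TangentSpace (𝓡 n) x) ℝ 0 (α x)

/-- Smooth 1-forms. -/
def OneForm.IsSmooth (α : OneForm n M) : Prop := α.toDiffForm.IsSmooth

/-- Closed 1-forms, `dα = 0`. -/
def OneForm.IsClosed (α : OneForm n M) : Prop := α.toDiffForm.IsClosed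

/-- The differential `dh` of a function `h : M → ℝ`. -/
def dFun (h : M → ℝ) : OneForm n M := fun x => mvfderiv (𝓡 n) h x

/-- Smooth closed 1-forms. -/
abbrev ClosedOneForm (n : ℕ) (M : Type*) [TopologicalSpace M]
    [ChartedSpace (EuclideanSpace ℝ (Fin n)) M] : Type _ :=
  {α : OneForm n M // α.IsSmooth ∧ α.IsClosed}

/-- Two smooth closed 1-forms are cohomologous if they differ by the differential of a smooth
function. -/
def cohomologous (n : ℕ) (M : Type*) [TopologicalSpace M]
    [ChartedSpace (EuclideanSpace ℝ (Fin n)) M] : Setoid (ClosedOneForm n M) where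
  r α β := ∃ h : M → ℝ, ContMDiff (𝓡 n) 𝓘(ℝ, ℝ) ∞ h ∧ α.1 - β.1 = dFun h
  iseqv := by
    refine ⟨fun α => ⟨fun _ => 0, contMDiff_const, ?_⟩, ?_, ?_⟩
    · funext x
      simp only [sub_self]
      exact (mvfderiv_const (0 : ℝ)).symm
    · rintro α β ⟨h, hs, hd⟩
      refine ⟨-h, hs.neg, ?_⟩
      rw [← neg_sub, hd]
      funext x
      simp [dFun]
    · rintro α β γ ⟨h, hs, hd⟩ ⟨k, ks, kd⟩
      refine ⟨h + k, hs.add ks, ?_⟩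
      rw [← sub_add_sub_cancel α.1 β.1 γ.1, hd, kd]
      funext x
      exact (mvfderiv_add (hs.mdifferentiable (by simp) x) (ks.mdifferentiable (by simp) x)).symm

/-- The first de Rham cohomology `H¹(M)`: smooth closed 1-forms modulo differentials of smooth
functions. -/
def DeRhamH1 (n : ℕ) (M : Type*) [TopologicalSpace M]
    [ChartedSpace (EuclideanSpace ℝ (Fin n)) M] : Type _ :=
  Quotient (cohomologous n M)

/-- The cohomology class of a smooth closed 1-form. -/
def ClosedOneForm.class (α : ClosedOneForm n M) : DeRhamH1 n M := Quotient.mk _ α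

end Forms

section Metric

variable {n : ℕ} {M : Type*} [TopologicalSpace M] [ChartedSpace (EuclideanSpace ℝ (Fin n)) M]
  [IsManifold (𝓡 n) ∞ M]

/-- Smooth Riemannian metrics on `M`. -/
abbrev Metric (n : ℕ) (M : Type*) [TopologicalSpace M] [ChartedSpace (EuclideanSpace ℝ (Fin n)) M]
    [IsManifold (𝓡 n) ∞ M] : Type _ :=
  Bundle.ContMDiffRiemannianMetric (𝓡 n) ∞ (EuclideanSpace ℝ (Fin n))
    (fun x : M => TangentSpace (𝓡 n) x)

theorem exists_sharp (g : Metric n M) (x : M) (a : TangentSpace (𝓡 n) x →L[ℝ] ℝ) :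
    ∃ v : TangentSpace (𝓡 n) x, ∀ w, g.inner x v w = a w := by
  have : FiniteDimensional ℝ (TangentSpace (𝓡 n) x) :=
    inferInstanceAs (FiniteDimensional ℝ (EuclideanSpace ℝ (Fin n)))
  let L : TangentSpace (𝓡 n) x →ₗ[ℝ] Module.Dual ℝ (TangentSpace (𝓡 n) x) :=
    { toFun := fun v => (g.inner x v).toLinearMap
      map_add' := fun v w => by ext; simp
      map_smul' := fun c v => by ext; simp }
  have hL : Function.Injective L := by
    rw [injective_iff_map_eq_zero]
    intro v hv
    by_contra hne
    have h0 : g.inner x v v = 0 := LinearMap.congr_fun hv v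
    exact (g.pos x v hne).ne' h0
  obtain ⟨v, hv⟩ := (LinearMap.injective_iff_surjective_of_finrank_eq_finrank
    (Subspace.dual_finrank_eq (K := ℝ) (V := TangentSpace (𝓡 n) x)).symm).1 hL a.toLinearMap
  exact ⟨v, fun w => LinearMap.congr_fun hv w⟩

/-- The vector `a♯` which corresponds to the covector `a` at `x` under the metric `g`. -/
def sharp (g : Metric n M) (x : M) (a : TangentSpace (𝓡 n) x →L[ℝ] ℝ) : TangentSpace (𝓡 n) x :=
  (exists_sharp g x a).choose

theorem sharp_spec (g : Metric n M) (x : M) (a : TangentSpace (𝓡 n) x →L[ℝ] ℝ)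
    (w : TangentSpace (𝓡 n) x) : g.inner x (sharp g x a) w = a w :=
  (exists_sharp g x a).choose_spec w

/-- The pointwise inner product `⟨⟨α, β⟩⟩` of 1-forms. -/
def formInner (g : Metric n M) (α β : OneForm n M) (x : M) : ℝ :=
  g.inner x (sharp g x (α x)) (sharp g x (β x))

/-- The Gram determinant `det (g_ij)` of the metric in the chart `e`, at the point with
coordinates `y`. -/
def gramDet (g : Metric n M) (e : OpenPartialHomeomorph M (EuclideanSpace ℝ (Fin n)))
    (y : EuclideanSpace ℝ (Fin n)) : ℝ :=
  (Matrix.of fun i j : Fin n => g.inner (e.symm y)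
    (mfderiv (𝓡 n) (𝓡 n) e.symm y (EuclideanSpace.single i 1 : EuclideanSpace ℝ (Fin n)))
    (mfderiv (𝓡 n) (𝓡 n) e.symm y (EuclideanSpace.single j 1 : EuclideanSpace ℝ (Fin n)))).det

/-- The measure `√(det g_ij) dy` on the domain of the chart `e`, extended by zero to `M`. -/
def chartVolume [MeasurableSpace M] (g : Metric n M)
    (e : OpenPartialHomeomorph M (EuclideanSpace ℝ (Fin n))) : Measure M :=
  (((volume : Measure (EuclideanSpace ℝ (Fin n))).restrict e.target).withDensity
    fun y => ENNReal.ofReal (Real.sqrt (gramDet g e y))).map e.symm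

/-- The Riemannian measure `dV_g`. The measures `chartVolume g e` agree on the overlaps of the chart
domains, so that their supremum is the measure on `M` which restricts to `√(det g_ij) dy` on the
domain of each chart. -/
def riemannianMeasure [MeasurableSpace M] (g : Metric n M) : Measure M :=
  ⨆ x : M, chartVolume g (chartAt (EuclideanSpace ℝ (Fin n)) x)

variable [MeasurableSpace M]

/-- A 1-form belongs to `L²_λ`: its pointwise norm is square integrable. -/
def OneForm.MemL2 (g : Metric n M) (lam : Measure M) (α : OneForm n M) : Prop :=
  MemLp (fun x => Real.sqrt (formInner g α α x)) 2 lam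

/-- A vector field belongs to `L²_λ`: its pointwise norm is square integrable. -/
def vectorFieldMemL2 (g : Metric n M) (lam : Measure M) (X : ∀ x : M, TangentSpace (𝓡 n) x) :
    Prop :=
  MemLp (fun x => Real.sqrt (g.inner x (X x) (X x))) 2 lam

/-- `δ_λ α = u`, where `δ_λ` is the formal adjoint of `d` with respect to `λ`:
`∫ ⟨⟨α, dφ⟩⟩ dλ = ∫ u φ dλ` for all compactly supported smooth functions `φ`. -/
def HasCodifferential (g : Metric n M) (lam : Measure M) (α : OneForm n M) (u : M → ℝ) : Prop :=
  ∀ φ : M → ℝ, ContMDiff (𝓡 n) 𝓘(ℝ, ℝ) ∞ φ → HasCompactSupport φ →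
    ∫ x, formInner g α (dFun φ) x ∂lam = ∫ x, u x * φ x ∂lam

/-- The smooth `L²_λ` 1-forms which are `λ`-harmonic: `dα = 0` and `δ_λ α = 0`. -/
structure IsL2Harmonic (g : Metric n M) (lam : Measure M) (α : OneForm n M) : Prop where
  smooth : α.IsSmooth
  closed : α.IsClosed
  coclosed : HasCodifferential g lam α 0
  memL2 : α.MemL2 g lam

/-- Every smooth closed 1-form in `L²_λ` is an `L²_λ`-orthogonal sum `dh + χ`, where `h` and `dh`
are in `L²_λ` and `χ` is `λ`-harmonic and in `L²_λ`. -/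
def HasHodgeDecomposition (g : Metric n M) (lam : Measure M) : Prop :=
  ∀ α : OneForm n M, α.IsSmooth → α.IsClosed → α.MemL2 g lam →
    ∃ (h : M → ℝ) (χ : OneForm n M), ContMDiff (𝓡 n) 𝓘(ℝ, ℝ) ∞ h ∧ MemLp h 2 lam ∧
      (dFun h : OneForm n M).MemL2 g lam ∧ IsL2Harmonic g lam χ ∧ α = dFun h + χ ∧
      ∫ x, formInner g (dFun h) χ x ∂lam = 0

/-- Each class in `H¹(M)` has a unique `λ`-harmonic representative in `L²_λ`. -/
def HasUniqueHarmonicRepresentatives (g : Metric n M) (lam : Measure M) : Prop :=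
  ∀ c : DeRhamH1 n M, ∃! χ : ClosedOneForm n M, χ.class = c ∧ IsL2Harmonic g lam χ.1

end Metric

section Symplectic

variable {n : ℕ} {M : Type*} [TopologicalSpace M] [ChartedSpace (EuclideanSpace ℝ (Fin n)) M]
  [IsManifold (𝓡 n) ∞ M]

/-- Symplectic forms: smooth closed nondegenerate 2-forms. -/
structure IsSymplectic (Ω : DiffForm n M 2) : Prop where
  smooth : Ω.IsSmooth
  closed : Ω.IsClosed
  nondegenerate : ∀ (x : M) (u : TangentSpace (𝓡 n) x), (∀ v, Ω x ![u, v] = 0) → u = 0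

/-- Fields of endomorphisms of the tangent spaces. -/
abbrev EndField (n : ℕ) (M : Type*) [TopologicalSpace M]
    [ChartedSpace (EuclideanSpace ℝ (Fin n)) M] : Type _ :=
  ∀ x : M, TangentSpace (𝓡 n) x →L[ℝ] TangentSpace (𝓡 n) x

/-- Almost complex structures: smooth fields of endomorphisms `J` with `J² = -1`. -/
structure IsAlmostComplex (J : EndField n M) : Prop where
  smooth : ContMDiff (𝓡 n)
    ((𝓡 n).prod 𝓘(ℝ, EuclideanSpace ℝ (Fin n) →L[ℝ] EuclideanSpace ℝ (Fin n))) ∞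
    (fun x => Bundle.TotalSpace.mk'
      (EuclideanSpace ℝ (Fin n) →L[ℝ] EuclideanSpace ℝ (Fin n))
      (E := fun x : M => TangentSpace (𝓡 n) x →L[ℝ] TangentSpace (𝓡 n) x) x (J x))
  sq : ∀ (x : M) (v : TangentSpace (𝓡 n) x), J x (J x v) = -v

/-- `(Ω, g, J)` is a compatible triple: `Ω` is symplectic, `J` is an almost complex structure and
`g(u, v) = Ω(u, J v)`. -/
structure IsCompatibleTriple (Ω : DiffForm n M 2) (g : Metric n M) (J : EndField n M) : Prop where
  symplectic : IsSymplectic Ω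
  almostComplex : IsAlmostComplex J
  compatible : ∀ (x : M) (u v : TangentSpace (𝓡 n) x), g.inner x u v = Ω x ![u, J x v]

/-- The action of `J` on 1-forms, `(J α)(v) = α (J v)`. -/
def OneForm.applyJ (J : EndField n M) (α : OneForm n M) : OneForm n M :=
  fun x => (α x).comp (J x)

end Symplectic

section Action

variable {m n : ℕ} (G : Type*) [TopologicalSpace G] [ChartedSpace (EuclideanSpace ℝ (Fin m)) G]
  [Group G] {M : Type*} [TopologicalSpace M] [ChartedSpace (EuclideanSpace ℝ (Fin n)) M]
  [MulAction G M]

/-- The Lie algebra `𝔤 = T_1 G`. -/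
abbrev LieAlg (m : ℕ) (G : Type*) [TopologicalSpace G]
    [ChartedSpace (EuclideanSpace ℝ (Fin m)) G] [Group G] : Type _ :=
  GroupLieAlgebra (𝓡 m) G

/-- The derivative at `x` of the diffeomorphism of `M` given by `a : G`. -/
def actionDeriv {G : Type*} [Group G] [MulAction G M] (a : G) (x : M) :
    TangentSpace (𝓡 n) x →L[ℝ] TangentSpace (𝓡 n) (a • x) :=
  mfderiv (𝓡 n) (𝓡 n) (fun y : M => a • y) x

/-- `G` preserves `Ω`, `g` and `J`. -/
structure IsInvariantTriple [IsManifold (𝓡 n) ∞ M] (G : Type*) [Group G] [MulAction G M]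
    (Ω : DiffForm n M 2) (g : Metric n M) (J : EndField n M) : Prop where
  form : ∀ (a : G) (x : M) (u v : TangentSpace (𝓡 n) x),
    Ω (a • x) ![actionDeriv a x u, actionDeriv a x v] = Ω x ![u, v]
  metric : ∀ (a : G) (x : M) (u v : TangentSpace (𝓡 n) x),
    g.inner (a • x) (actionDeriv a x u) (actionDeriv a x v) = g.inner x u v
  complex : ∀ (a : G) (x : M) (v : TangentSpace (𝓡 n) x),
    J (a • x) (actionDeriv a x v) = actionDeriv a x (J x v)

variable {G}

/-- The infinitesimal generator `ξ_M(x) = d/dt|_{t=0} exp(tξ) · x`, written as the value at `ξ` of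
the derivative at `1` of the orbit map `a ↦ a · x`; see `hasMFDerivAt_infGen`. -/
def infGen (ξ : LieAlg m G) (x : M) : TangentSpace (𝓡 n) x :=
  mfderiv (𝓡 m) (𝓡 n) (fun a : G => a • x) 1 ξ

/-- If `γ` is a curve in `G` with `γ(0) = 1` and `γ'(0) = ξ`, for instance `γ(t) = exp(tξ)`, then
`d/dt|_{t=0} γ(t) · x = ξ_M(x)`. -/
theorem hasMFDerivAt_infGen [ContMDiffSMul (𝓡 m) (𝓡 n) ∞ G M] (ξ : LieAlg m G) (x : M)
    (γ : ℝ → G) (h1 : γ 0 = 1)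
    (hγ : HasMFDerivAt 𝓘(ℝ, ℝ) (𝓡 m) γ 0 (ContinuousLinearMap.toSpanSingleton ℝ ξ)) :
    HasMFDerivAt 𝓘(ℝ, ℝ) (𝓡 n) (fun t => γ t • x) 0
      (ContinuousLinearMap.toSpanSingleton ℝ (infGen (n := n) ξ x)) := by
  have hs : MDifferentiableAt (𝓡 m) (𝓡 n) (fun a : G => a • x) (γ 0) :=
    ((ContMDiffSMul.contMDiff_smul (I := 𝓡 m) (I' := 𝓡 n) (n := ∞) (G := G) (M := M)).comp
      (contMDiff_id.prodMk contMDiff_const)).mdifferentiable (by simp) (γ 0)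
  have hc := hs.hasMFDerivAt.comp (0 : ℝ) hγ
  have he : ∀ a : G, a = 1 →
      (mfderiv (𝓡 m) (𝓡 n) (fun a : G => a • x) a : EuclideanSpace ℝ (Fin m) → _) ξ =
        (infGen (n := n) ξ x : EuclideanSpace ℝ (Fin n)) := by
    rintro a rfl
    rfl
  have hd : ((mfderiv (𝓡 m) (𝓡 n) (fun a : G => a • x) (γ 0)).comp
      (ContinuousLinearMap.toSpanSingleton ℝ ξ) : ℝ →L[ℝ] EuclideanSpace ℝ (Fin n)) =
      ContinuousLinearMap.toSpanSingleton ℝ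
        (infGen (n := n) ξ x : EuclideanSpace ℝ (Fin n)) := by
    apply ContinuousLinearMap.ext
    intro t
    refine (ContinuousLinearMap.map_smul _ t ξ).trans ?_
    exact congrArg (t • ·) (he (γ 0) h1)
  exact hd ▸ hc

/-- The adjoint action of `G` on `𝔤`: the derivative at `1` of `b ↦ a b a⁻¹`. -/
def Ad (a : G) (ξ : LieAlg m G) : LieAlg m G :=
  mfderiv (𝓡 m) (𝓡 m) (fun b : G => a * b * a⁻¹) 1 ξ

/-- The action of `G` on `(M, Ω)` is Hamiltonian: there is a momentum map `μ : M → 𝔤*`, i.e. a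
smooth map which is equivariant for the coadjoint action on `𝔤*`, that is,
`⟨μ(a · x), Ad_a ξ⟩ = ⟨μ(x), ξ⟩`, and satisfies `Ω(ξ_M, ·) = d⟨μ, ξ⟩` for all `ξ ∈ 𝔤`. (The vector
space underlying `𝔤 = T_1 G` is the model space of `G`.) -/
def IsHamiltonian (m : ℕ) (G : Type*) [TopologicalSpace G] [ChartedSpace (EuclideanSpace ℝ (Fin m)) G]
    [Group G] [MulAction G M] (Ω : DiffForm n M 2) : Prop :=
  ∃ μ : M → EuclideanSpace ℝ (Fin m) →L[ℝ] ℝ,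
    ContMDiff (𝓡 n) 𝓘(ℝ, EuclideanSpace ℝ (Fin m) →L[ℝ] ℝ) ∞ μ ∧
    (∀ (a : G) (x : M) (ξ : LieAlg m G), μ (a • x) (Ad a ξ) = μ x ξ) ∧
    ∀ (ξ : LieAlg m G) (x : M) (v : TangentSpace (𝓡 n) x),
      Ω x ![infGen ξ x, v] = dFun (fun y => μ y ξ) x v

end Action

end HamAct

end

/-! For `ξ` in the Lie algebra put `α = Ω(ξ_M, ·)`. Since the action preserves the closed form `Ω`,
Cartan's formula makes `α` closed, and `α` is in `L²_λ` because its pointwise norm is that of `ξ_M`.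
The Hodge decomposition gives `α = dh + χ` with `χ` harmonic, and the main point is that `χ = 0`
(`generatorForm_exact`).

Every harmonic form vanishes on the generators (`IsL2Harmonic.apply_infGen`). Indeed the pullback of
a harmonic form by `a : G` is again harmonic, and it is cohomologous to the original because `G` is
connected; by uniqueness of harmonic representatives the two agree. For an invariant closed form the
function `x ↦ χ x (ξ_M x)` is locally constant, and it is zero at fixed points, of which every
component has one.

The vector dual to `α` is `J ξ_M`, so `⟨⟨α, χ⟩⟩ = (Jχ)(ξ_M)`, which vanishes pointwise because `Jχ`
is harmonic too. Hence `⟨⟨χ, χ⟩⟩ = -⟨⟨dh, χ⟩⟩`, whose integral is zero by orthogonality, and `χ = 0`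
almost everywhere. The density may vanish on open sets, so uniqueness of representatives is used
once more to get `χ = 0` everywhere (`IsL2Harmonic.eq_zero_of_ae`).

Finally the primitives are normalized to vanish at one chosen fixed point in each component. This
makes them unique, hence linear in `ξ` and equivariant, and they assemble to a momentum map
(`isHamiltonian_of_exact`).

Closed 1-forms are handled throughout by local primitives, which pull back and subtract more easily
than coordinate expressions. -/

namespace HamAct

open Filter Topology

/-! ### Exterior derivative of 1-forms on a vector space -/

section AlternatingDegreeOne

variable {E : Type*} [NormedAddCommGroup E] [NormedSpace ℝ E]

/-- Continuous linear forms, seen as alternating forms of degree one. -/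
noncomputable def altOne (E : Type*) [NormedAddCommGroup E] [NormedSpace ℝ E] :
    (E →L[ℝ] ℝ) ≃ₗᵢ[ℝ] (E [⋀^Fin 1]→L[ℝ] ℝ) where
  toFun := ContinuousAlternatingMap.ofSubsingleton ℝ E ℝ 0
  invFun := (ContinuousAlternatingMap.ofSubsingleton ℝ E ℝ 0).symm
  left_inv := Equiv.left_inv _
  right_inv := Equiv.right_inv _
  map_add' _ _ := rfl
  map_smul' _ _ := rfl
  norm_map' f := ContinuousAlternatingMap.norm_ofSubsingleton 0 f

theorem altOne_apply (f : E →L[ℝ] ℝ) (v : Fin 1 → E) : altOne E f v = f (v 0) := rfl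

theorem extDeriv_altOne_apply {η : E → E →L[ℝ] ℝ} {y : E} (h : DifferentiableAt ℝ η y)
    (v : Fin 2 → E) :
    extDeriv (fun z => altOne E (η z)) y v =
      fderiv ℝ η y (v 0) (v 1) - fderiv ℝ η y (v 1) (v 0) := by
  have hd : ∀ u w : E, fderiv ℝ (fun z => η z u) y w = fderiv ℝ η y w u := by
    intro u w
    rw [fderiv_clm_apply h (differentiableAt_const u)]
    simp
  have hη : DifferentiableAt ℝ (fun z => altOne E (η z)) y :=
    (altOne E).toContinuousLinearEquiv.differentiableAt.comp y h
  rw [extDeriv_apply hη]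
  simp [Fin.sum_univ_two, altOne_apply, hd, Fin.removeNth, sub_eq_add_neg]

theorem extDeriv_altOne_eq_zero_iff {η : E → E →L[ℝ] ℝ} {y : E} (h : DifferentiableAt ℝ η y) :
    extDeriv (fun z => altOne E (η z)) y = 0 ↔
      ∀ u v, fderiv ℝ η y u v = fderiv ℝ η y v u := by
  constructor
  · intro h0 u v
    have := extDeriv_altOne_apply h ![u, v]
    rw [h0] at this
    exact sub_eq_zero.1 this.symm
  · intro hs
    ext v
    rw [extDeriv_altOne_apply h, hs, sub_self]
    rfl

end AlternatingDegreeOne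

/-! ### Smooth closed 1-forms are the locally exact ones -/

section LocallyExact

variable {n : ℕ} {M : Type*} [TopologicalSpace M] [ChartedSpace (EuclideanSpace ℝ (Fin n)) M]

/-- The coordinate expression of a 1-form in the chart `e`. -/
noncomputable def OneForm.coord (α : OneForm n M)
    (e : OpenPartialHomeomorph M (EuclideanSpace ℝ (Fin n))) (y : EuclideanSpace ℝ (Fin n)) :
    EuclideanSpace ℝ (Fin n) →L[ℝ] ℝ :=
  (α (e.symm y)).comp (mfderiv (𝓡 n) (𝓡 n) e.symm y)

theorem OneForm.inChart_toDiffForm (α : OneForm n M)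
    (e : OpenPartialHomeomorph M (EuclideanSpace ℝ (Fin n))) :
    α.toDiffForm.inChart e = fun y => altOne _ (α.coord e y) := by
  funext y
  ext v
  rfl

theorem OneForm.isSmooth_iff (α : OneForm n M) :
    α.IsSmooth ↔ ∀ x : M, ContDiffOn ℝ ∞ (α.coord (chartAt _ x))
      (chartAt (EuclideanSpace ℝ (Fin n)) x).target := by
  refine forall_congr' fun x => ?_
  rw [OneForm.inChart_toDiffForm]
  exact (altOne (EuclideanSpace ℝ (Fin n))).toContinuousLinearEquiv.comp_contDiffOn_iff

theorem OneForm.IsSmooth.isClosed_iff {α : OneForm n M} (hα : α.IsSmooth) :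
    α.IsClosed ↔ ∀ x : M, ∀ y ∈ (chartAt (EuclideanSpace ℝ (Fin n)) x).target, ∀ u v,
      fderiv ℝ (α.coord (chartAt _ x)) y u v = fderiv ℝ (α.coord (chartAt _ x)) y v u := by
  refine forall_congr' fun x => forall₂_congr fun y hy => ?_
  rw [OneForm.inChart_toDiffForm]
  refine extDeriv_altOne_eq_zero_iff ?_
  exact (((α.isSmooth_iff.1 hα x).contDiffAt
    ((chartAt _ x).open_target.mem_nhds hy)).differentiableAt (by simp))

/-- `F` is a smooth primitive of `α` near `x`. -/
def OneForm.IsPrimitiveNear (α : OneForm n M) (F : M → ℝ) (x : M) : Prop :=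
  ∀ᶠ y in 𝓝 x, ContMDiffAt (𝓡 n) 𝓘(ℝ, ℝ) ∞ F y ∧ α y = dFun F y

/-- A 1-form is locally exact if it has smooth primitives locally. -/
def OneForm.LocallyExact (α : OneForm n M) : Prop :=
  ∀ x : M, ∃ F : M → ℝ, α.IsPrimitiveNear F x

theorem OneForm.IsPrimitiveNear.eventually {α : OneForm n M} {F : M → ℝ} {x : M}
    (h : α.IsPrimitiveNear F x) : ∀ᶠ y in 𝓝 x, α.IsPrimitiveNear F y :=
  eventually_eventually_nhds.2 h

theorem dFun_locallyExact {F : M → ℝ} (hF : ContMDiff (𝓡 n) 𝓘(ℝ, ℝ) ∞ F) :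
    (dFun F : OneForm n M).LocallyExact :=
  fun _ => ⟨F, Filter.Eventually.of_forall fun y => ⟨hF y, rfl⟩⟩

variable [IsManifold (𝓡 n) ∞ M]

theorem mdifferentiable_chartAt (x : M) :
    (chartAt (EuclideanSpace ℝ (Fin n)) x).MDifferentiable (𝓡 n) (𝓡 n) :=
  haveI : IsManifold (𝓡 n) 1 M := IsManifold.of_le (n := ∞) (by simp)
  mdifferentiable_chart x

theorem OneForm.coord_dFun {F : M → ℝ} (x : M) {y : EuclideanSpace ℝ (Fin n)}
    (hy : y ∈ (chartAt (EuclideanSpace ℝ (Fin n)) x).target)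
    (hF : MDifferentiableAt (𝓡 n) 𝓘(ℝ, ℝ) F ((chartAt (EuclideanSpace ℝ (Fin n)) x).symm y)) :
    OneForm.coord (dFun F) (chartAt (EuclideanSpace ℝ (Fin n)) x) y =
      fderiv ℝ (F ∘ (chartAt (EuclideanSpace ℝ (Fin n)) x).symm) y := by
  have h := mfderiv_comp y hF ((mdifferentiable_chartAt x).mdifferentiableAt_symm hy)
  rw [mfderiv_eq_fderiv] at h
  exact h.symm

/-- The derivative of a chart is invertible, so a covector can be recovered from its coordinate
expression. -/
theorem OneForm.eq_of_coord_eq {α β : OneForm n M} (x : M) {y : M}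
    (hy : y ∈ (chartAt (EuclideanSpace ℝ (Fin n)) x).source)
    (h : α.coord (chartAt _ x) (chartAt _ x y) = β.coord (chartAt _ x) (chartAt _ x y)) :
    α y = β y := by
  have hc := (mdifferentiable_chartAt x).symm_comp_deriv hy
  have key : ∀ γ : OneForm n M, ∀ v : EuclideanSpace ℝ (Fin n), γ y v =
      γ.coord (chartAt _ x) (chartAt _ x y) 
        (mfderiv (𝓡 n) (𝓡 n) (chartAt (EuclideanSpace ℝ (Fin n)) x) y v) := by
    intro γ v
    -- Transport along an equality of base points: every tangent space is the model space by
    -- definition, so after the ascription both sides have the same type.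
    have h1 : ∀ z : M, z = y → (γ z : EuclideanSpace ℝ (Fin n) →L[ℝ] ℝ) =
        (γ y : EuclideanSpace ℝ (Fin n) →L[ℝ] ℝ) := by
      rintro z rfl; rfl
    have h2 := congrArg (γ y : EuclideanSpace ℝ (Fin n) →L[ℝ] ℝ) (DFunLike.congr_fun hc v)
    have h3 := h1 _ ((chartAt (EuclideanSpace ℝ (Fin n)) x).left_inv hy)
    refine h2.symm.trans ?_
    exact (DFunLike.congr_fun h3 _).symm
  ext v
  refine (key α v).trans (Eq.trans ?_ (key β v).symm)
  rw [h]

/-- Poincaré lemma: on a ball in the chart, symmetry of the derivative of the coordinate expression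
yields a primitive, which is carried back to `M`. -/
theorem OneForm.IsSmooth.locallyExact {α : OneForm n M} (hs : α.IsSmooth) (hc : α.IsClosed) :
    α.LocallyExact := by
  intro x
  have hη := α.isSmooth_iff.1 hs x
  have hsym := hs.isClosed_iff.1 hc x
  set e := chartAt (EuclideanSpace ℝ (Fin n)) x with he
  obtain ⟨r, hr, hball⟩ := Metric.isOpen_iff.1 e.open_target (e x)
    (e.map_source (mem_chart_source _ x))
  obtain ⟨f, hf⟩ := (convex_ball (e x) r).exists_forall_hasFDerivAt_of_fderiv_symmetric
    Metric.isOpen_ball ((hη.mono hball).differentiableOn (by simp))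
    (fun a ha => hsym a (hball ha))
  have hfs : ContDiffOn ℝ ∞ f (Metric.ball (e x) r) := by
    rw [contDiffOn_infty_iff_fderiv_of_isOpen Metric.isOpen_ball]
    exact ⟨fun a ha => (hf a ha).differentiableAt.differentiableWithinAt,
      (hη.mono hball).congr fun a ha => (hf a ha).fderiv⟩
  refine ⟨f ∘ e, ?_⟩
  have hnb : ∀ᶠ y in 𝓝 x, y ∈ e.source ∧ e y ∈ Metric.ball (e x) r := by
    filter_upwards [e.open_source.mem_nhds (mem_chart_source _ x),
      (e.continuousAt (mem_chart_source _ x)).preimage_mem_nhds (Metric.ball_mem_nhds _ hr)]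
      with y h1 h2 using ⟨h1, h2⟩
  filter_upwards [hnb] with y ⟨hy, hyb⟩
  have hF : ContMDiffAt (𝓡 n) 𝓘(ℝ, ℝ) ∞ (f ∘ e) y := by
    refine ContMDiffAt.comp y (I' := 𝓡 n) ?_ ?_
    · exact ((hfs.contDiffAt (Metric.isOpen_ball.mem_nhds hyb)).contMDiffAt)
    · exact (contMDiffOn_chart (I := 𝓡 n) (n := ∞) (x := x)).contMDiffAt (e.open_source.mem_nhds hy)
  refine ⟨hF, OneForm.eq_of_coord_eq x hy ?_⟩
  rw [OneForm.coord_dFun x (e.map_source hy)]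
  · rw [← (hf _ hyb).fderiv]
    refine Filter.EventuallyEq.fderiv_eq ?_
    filter_upwards [e.open_target.mem_nhds (e.map_source hy)] with z hz
    exact congrArg f (e.right_inv hz).symm
  · rw [e.left_inv hy]
    exact hF.mdifferentiableAt (by simp)

theorem OneForm.LocallyExact.eventually_coord {α : OneForm n M} (h : α.LocallyExact) (x : M)
    {y : EuclideanSpace ℝ (Fin n)} (hy : y ∈ (chartAt (EuclideanSpace ℝ (Fin n)) x).target) :
    ∃ f : EuclideanSpace ℝ (Fin n) → ℝ, ContDiffAt ℝ ∞ f y ∧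
      α.coord (chartAt _ x) =ᶠ[𝓝 y] fderiv ℝ f := by
  set e := chartAt (EuclideanSpace ℝ (Fin n)) x with he
  obtain ⟨F, hF⟩ := h (e.symm y)
  refine ⟨F ∘ e.symm, ?_, ?_⟩
  · rw [← contMDiffAt_iff_contDiffAt]
    refine ContMDiffAt.comp y (I' := 𝓡 n) hF.self_of_nhds.1 ?_
    exact (contMDiffOn_chart_symm (I := 𝓡 n) (n := ∞) (x := x)).contMDiffAt
      (e.open_target.mem_nhds hy)
  · filter_upwards [(e.symm.continuousAt hy).eventually hF, e.open_target.mem_nhds hy] with z hz hzt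
    rw [← OneForm.coord_dFun x hzt (hz.1.mdifferentiableAt (by simp))]
    simp only [OneForm.coord]
    rw [hz.2]

theorem OneForm.LocallyExact.isSmooth {α : OneForm n M} (h : α.LocallyExact) : α.IsSmooth := by
  rw [OneForm.isSmooth_iff]
  intro x y hy
  obtain ⟨f, hf, hαf⟩ := h.eventually_coord x hy
  exact ((hf.fderiv_right (m := ∞) (by simp)).congr_of_eventuallyEq hαf).contDiffWithinAt

/-- In coordinates the form is locally `fderiv ℝ f`, and second derivatives are symmetric. -/
theorem OneForm.LocallyExact.isClosed {α : OneForm n M} (h : α.LocallyExact) : α.IsClosed := by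
  rw [h.isSmooth.isClosed_iff]
  intro x y hy u v
  obtain ⟨f, hf, hαf⟩ := h.eventually_coord x hy
  rw [hαf.fderiv_eq]
  exact (hf.isSymmSndFDerivAt (by simpa using ENat.LEInfty.out)) u v

end LocallyExact

/-! ### Pullbacks and calculus of local primitives -/

section Pullback

variable {n : ℕ} {M : Type*} [TopologicalSpace M] [ChartedSpace (EuclideanSpace ℝ (Fin n)) M]

/-- The pullback of a 1-form under a map. -/
noncomputable def OneForm.pullback (φ : M → M) (β : OneForm n M) : OneForm n M :=
  fun x => (β (φ x)).comp (mfderiv (𝓡 n) (𝓡 n) φ x)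

theorem dFun_comp {F : M → ℝ} {φ : M → M} {x : M}
    (hF : MDifferentiableAt (𝓡 n) 𝓘(ℝ, ℝ) F (φ x)) (hφ : MDifferentiableAt (𝓡 n) (𝓡 n) φ x) :
    (dFun (F ∘ φ) x : TangentSpace (𝓡 n) x →L[ℝ] ℝ) =
      (dFun F (φ x)).comp (mfderiv (𝓡 n) (𝓡 n) φ x) :=
  mvfderiv_comp x hF hφ

theorem hasDerivAt_comp_curve {F : M → ℝ} {c : ℝ → M} {t : ℝ}
    (hF : MDifferentiableAt (𝓡 n) 𝓘(ℝ, ℝ) F (c t)) (hc : MDifferentiableAt 𝓘(ℝ, ℝ) (𝓡 n) c t) :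
    HasDerivAt (F ∘ c) ((dFun F (c t) : TangentSpace (𝓡 n) (c t) →L[ℝ] ℝ)
      (mfderiv 𝓘(ℝ, ℝ) (𝓡 n) c t (1 : ℝ))) t := by
  let L : ℝ →L[ℝ] ℝ := (mfderiv (𝓡 n) 𝓘(ℝ, ℝ) F (c t)).comp (mfderiv 𝓘(ℝ, ℝ) (𝓡 n) c t)
  have h : HasFDerivAt (𝕜 := ℝ) (E := ℝ) (F := ℝ) (F ∘ c) L t :=
    (hF.hasMFDerivAt.comp t hc.hasMFDerivAt).hasFDerivAt
  exact h.hasDerivAt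

namespace OneForm.IsPrimitiveNear

variable {α β : OneForm n M} {F F' : M → ℝ} {x : M}

theorem zero : (0 : OneForm n M).IsPrimitiveNear (fun _ => 0) x :=
  Eventually.of_forall fun _ => ⟨contMDiffAt_const, (mvfderiv_const (0 : ℝ)).symm⟩

theorem add (h : α.IsPrimitiveNear F x) (h' : β.IsPrimitiveNear F' x) :
    (α + β).IsPrimitiveNear (F + F') x := by
  filter_upwards [h, h'] with y hy hy'
  refine ⟨hy.1.add hy'.1, ?_⟩
  rw [Pi.add_apply, hy.2, hy'.2]
  exact (mvfderiv_add (hy.1.mdifferentiableAt (by simp)) (hy'.1.mdifferentiableAt (by simp))).symm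

theorem sub (h : α.IsPrimitiveNear F x) (h' : β.IsPrimitiveNear F' x) :
    (α - β).IsPrimitiveNear (F - F') x := by
  filter_upwards [h, h'] with y hy hy'
  refine ⟨hy.1.sub hy'.1, ?_⟩
  rw [Pi.sub_apply, hy.2, hy'.2]
  exact (mvfderiv_sub (hy.1.mdifferentiableAt (by simp)) (hy'.1.mdifferentiableAt (by simp))).symm

theorem congr (h : α.IsPrimitiveNear F x) (hF : F' =ᶠ[𝓝 x] F) : α.IsPrimitiveNear F' x := by
  filter_upwards [h, eventually_eventually_nhds.2 hF] with y hy hFy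
  refine ⟨hy.1.congr_of_eventuallyEq hFy, hy.2.trans ?_⟩
  have := (Filter.EventuallyEq.mfderiv_eq (I := 𝓡 n) (I' := 𝓘(ℝ, ℝ)) hFy)
  exact this.symm

theorem pullback {φ : M → M} (hφ : ContMDiff (𝓡 n) (𝓡 n) ∞ φ)
    (h : β.IsPrimitiveNear F (φ x)) : (β.pullback φ).IsPrimitiveNear (F ∘ φ) x := by
  filter_upwards [hφ.continuous.continuousAt.eventually h] with y hy
  refine ⟨hy.1.comp y (hφ y), ?_⟩
  rw [dFun_comp (hy.1.mdifferentiableAt (by simp)) (hφ.mdifferentiable (by simp) y),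
    OneForm.pullback, hy.2]

end OneForm.IsPrimitiveNear

theorem OneForm.LocallyExact.pullback {β : OneForm n M} (h : β.LocallyExact) {φ : M → M}
    (hφ : ContMDiff (𝓡 n) (𝓡 n) ∞ φ) : (β.pullback φ).LocallyExact := by
  intro x
  obtain ⟨F, hF⟩ := h (φ x)
  exact ⟨_, hF.pullback hφ⟩

theorem OneForm.pullback_comp (β : OneForm n M) {φ ψ : M → M}
    (hφ : MDifferentiable (𝓡 n) (𝓡 n) φ) (hψ : MDifferentiable (𝓡 n) (𝓡 n) ψ) :
    β.pullback (φ ∘ ψ) = (β.pullback φ).pullback ψ := by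
  funext x
  simp only [OneForm.pullback]
  rw [mfderiv_comp x (hφ _) (hψ x)]
  rfl

theorem OneForm.pullback_id (β : OneForm n M) : β.pullback id = β := by
  funext x
  simp only [OneForm.pullback]
  rw [mfderiv_id]
  rfl

theorem OneForm.pullback_sub (α β : OneForm n M) (φ : M → M) :
    (α - β).pullback φ = α.pullback φ - β.pullback φ := by
  funext x
  exact ContinuousLinearMap.sub_comp _ _ _

theorem OneForm.pullback_dFun {F : M → ℝ} (hF : MDifferentiable (𝓡 n) 𝓘(ℝ, ℝ) F) {φ : M → M}
    (hφ : MDifferentiable (𝓡 n) (𝓡 n) φ) :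
    (dFun F : OneForm n M).pullback φ = dFun (F ∘ φ) := by
  funext x
  exact (dFun_comp (hF _) (hφ x)).symm

end Pullback

/-! ### Functions with vanishing differential -/

section Constant

variable {n : ℕ} {M : Type*} [TopologicalSpace M] [ChartedSpace (EuclideanSpace ℝ (Fin n)) M]
  [IsManifold (𝓡 n) ∞ M]

theorem eventually_eq_of_dFun_eq_zero {F : M → ℝ} {x : M}
    (h : ∀ᶠ y in 𝓝 x, MDifferentiableAt (𝓡 n) 𝓘(ℝ, ℝ) F y ∧
      (dFun F y : TangentSpace (𝓡 n) y →L[ℝ] ℝ) = 0) :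
    ∀ᶠ y in 𝓝 x, F y = F x := by
  set e := chartAt (EuclideanSpace ℝ (Fin n)) x with he
  have hx : x ∈ e.source := mem_chart_source _ x
  have h2 : ∀ᶠ z in 𝓝 (e x), DifferentiableAt ℝ (F ∘ e.symm) z ∧
      fderiv ℝ (F ∘ e.symm) z = 0 := by
    have hcont : Tendsto e.symm (𝓝 (e x)) (𝓝 x) := by
      have := e.symm.continuousAt (e.map_source hx)
      rwa [ContinuousAt, e.left_inv hx] at this
    filter_upwards [hcont.eventually h, e.open_target.mem_nhds (e.map_source hx)] with z hz hzt
    refine ⟨?_, ?_⟩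
    · exact (hz.1.comp z ((mdifferentiable_chartAt x).mdifferentiableAt_symm hzt)).differentiableAt
    · rw [← OneForm.coord_dFun x hzt hz.1, OneForm.coord, hz.2]
      exact ContinuousLinearMap.zero_comp _
  obtain ⟨r, hr, hball⟩ := Metric.eventually_nhds_iff_ball.1 h2
  have hc : ∀ z ∈ Metric.ball (e x) r, (F ∘ e.symm) z = (F ∘ e.symm) (e x) := fun z hz =>
    Metric.isOpen_ball.is_const_of_fderiv_eq_zero (convex_ball (e x) r).isPreconnected
      (fun w hw => (hball w hw).1.differentiableWithinAt) (fun w hw => (hball w hw).2)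
      hz (Metric.mem_ball_self hr)
  filter_upwards [e.open_source.mem_nhds hx,
    (e.continuousAt hx).preimage_mem_nhds (Metric.ball_mem_nhds _ hr)] with y hy hyb
  simpa [e.left_inv hy, e.left_inv hx] using hc _ hyb

theorem eq_of_dFun_eq_zero {F : M → ℝ} (hF : MDifferentiable (𝓡 n) 𝓘(ℝ, ℝ) F)
    (h : (dFun F : OneForm n M) = 0) {x y : M} (hy : y ∈ connectedComponent x) : F y = F x := by
  have hl : IsLocallyConstant F := (IsLocallyConstant.iff_eventually_eq F).2 fun z =>
    eventually_eq_of_dFun_eq_zero (Eventually.of_forall fun w => ⟨hF w, congrFun h w⟩)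
  exact hl.apply_eq_of_isPreconnected isPreconnected_connectedComponent hy
    mem_connectedComponent

end Constant

/-! ### Homotopy invariance of the cohomology class -/

section Homotopy

variable {n : ℕ} {M : Type*} [TopologicalSpace M] [ChartedSpace (EuclideanSpace ℝ (Fin n)) M]

/-- The value of `β` on the velocity of the curve `c` at time `t`. -/
noncomputable def OneForm.alongCurve (β : OneForm n M) (c : ℝ → M) (t : ℝ) : ℝ :=
  β (c t) (mfderiv 𝓘(ℝ, ℝ) (𝓡 n) c t (1 : ℝ))

theorem OneForm.IsPrimitiveNear.hasDerivAt {β : OneForm n M} {F : M → ℝ} {c : ℝ → M} {t : ℝ}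
    (h : β.IsPrimitiveNear F (c t)) (hc : MDifferentiableAt 𝓘(ℝ, ℝ) (𝓡 n) c t) :
    HasDerivAt (F ∘ c) (β.alongCurve c t) t := by
  rw [OneForm.alongCurve, h.self_of_nhds.2]
  exact hasDerivAt_comp_curve (h.self_of_nhds.1.mdifferentiableAt (by simp)) hc

theorem OneForm.LocallyExact.continuous_alongCurve {β : OneForm n M} (hβ : β.LocallyExact)
    {c : ℝ → M} (hc : ContMDiff 𝓘(ℝ, ℝ) (𝓡 n) ∞ c) : Continuous (β.alongCurve c) := by
  rw [continuous_iff_continuousAt]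
  intro t
  obtain ⟨F, hF⟩ := hβ (c t)
  have h1 : β.alongCurve c =ᶠ[𝓝 t] deriv (F ∘ c) := by
    filter_upwards [hc.continuous.continuousAt.eventually hF.eventually] with s hs
    exact (hs.hasDerivAt (hc.mdifferentiable (by simp) s)).deriv.symm
  have h2 : ContDiffAt ℝ ∞ (F ∘ c) t :=
    (hF.self_of_nhds.1.comp t (hc t)).contDiffAt
  have h3 : ContinuousAt (deriv (F ∘ c)) t := by
    have h4 : deriv (F ∘ c) = fun s => fderiv ℝ (F ∘ c) s 1 :=
      funext fun s => fderiv_apply_one_eq_deriv.symm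
    rw [h4]
    exact (h2.fderiv_right (m := 0) (by simp)).continuousAt.clm_apply continuousAt_const
  exact h3.congr h1.symm

/-- The primitive is `Φ t x`, the integral of `β` along the track `s ↦ H s x` from `0` to `t`, taken
at `t = 1`. No differentiation under the integral is needed: near a given time and point, changing
the time changes `Φ` by a difference of values of a local primitive of `β`. So being a primitive of
`(H t)^* β - (H 0)^* β` near `x` is a locally constant condition on `t`, and it holds at `t = 0`. -/
theorem OneForm.LocallyExact.exists_homotopy_primitive {β : OneForm n M} (hβ : β.LocallyExact)
    {H : ℝ → M → M} (hH : ContMDiff (𝓘(ℝ, ℝ).prod (𝓡 n)) (𝓡 n) ∞ (fun p : ℝ × M => H p.1 p.2)) :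
    ∃ Φ : M → ℝ, ContMDiff (𝓡 n) 𝓘(ℝ, ℝ) ∞ Φ ∧
      β.pullback (H 1) - β.pullback (H 0) = dFun Φ := by
  have hcurve : ∀ x, ContMDiff 𝓘(ℝ, ℝ) (𝓡 n) ∞ (fun t => H t x) := fun x =>
    hH.comp (contMDiff_id.prodMk contMDiff_const)
  have hmap : ∀ t, ContMDiff (𝓡 n) (𝓡 n) ∞ (H t) := fun t =>
    hH.comp (contMDiff_const.prodMk contMDiff_id)
  have hint : ∀ x a b, IntervalIntegrable (β.alongCurve fun t => H t x) volume a b := fun x a b =>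
    (hβ.continuous_alongCurve (hcurve x)).intervalIntegrable a b
  set Φ : ℝ → M → ℝ := fun t x => ∫ s in (0 : ℝ)..t, β.alongCurve (fun t => H t x) s with hΦ
  -- A product neighbourhood of `(t, x)` is mapped into the domain of a single primitive `F`, so the
  -- fundamental theorem of calculus applies along all tracks starting near `x`.
  have step : ∀ x t, ∃ ε > 0, ∃ F : M → ℝ, ∀ s ∈ Metric.ball t ε,
      β.IsPrimitiveNear F (H s x) ∧ ∀ s' ∈ Metric.ball t ε, ∀ᶠ y in 𝓝 x,
        Φ s' y = Φ s y + (F (H s' y) - F (H s y)) := by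
    intro x t
    obtain ⟨F, hF⟩ := hβ (H t x)
    have hev := hH.continuous.continuousAt (x := (t, x)) |>.eventually hF.eventually
    rw [nhds_prod_eq] at hev
    obtain ⟨p, hp, q, hq, hpq⟩ := Filter.eventually_prod_iff.1 hev
    obtain ⟨ε, hε, hball⟩ := Metric.eventually_nhds_iff_ball.1 hp
    refine ⟨ε, hε, F, fun s hs => ⟨hpq (hball s hs) hq.self_of_nhds, fun s' hs' => ?_⟩⟩
    filter_upwards [hq] with y hy
    have hseg : uIcc s s' ⊆ Metric.ball t ε := by
      rw [← segment_eq_uIcc]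
      exact (convex_ball t ε).segment_subset hs hs'
    have hFTC := intervalIntegral.integral_eq_sub_of_hasDerivAt (f := F ∘ fun t => H t y)
      (fun r hr => (hpq (hball r (hseg hr)) hy).hasDerivAt
        ((hcurve y).mdifferentiable (by simp) r)) (hint y s s')
    rw [hΦ]
    simp only
    rw [← intervalIntegral.integral_add_adjacent_intervals (hint y 0 s) (hint y s s'), hFTC]
    rfl
  -- Local constancy of a `Prop`-valued function on the line, which replaces a subdivision of the
  -- interval.
  have hlc : ∀ x, IsLocallyConstant fun t =>
      (β.pullback (H t) - β.pullback (H 0)).IsPrimitiveNear (Φ t) x := by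
    intro x
    rw [IsLocallyConstant.iff_eventually_eq]
    intro t
    obtain ⟨ε, hε, F, hF⟩ := step x t
    have himp : ∀ s ∈ Metric.ball t ε, ∀ s' ∈ Metric.ball t ε,
        (β.pullback (H s) - β.pullback (H 0)).IsPrimitiveNear (Φ s) x →
        (β.pullback (H s') - β.pullback (H 0)).IsPrimitiveNear (Φ s') x := by
      intro s hs s' hs' h
      have h1 := h.add (((hF s' hs').1.pullback (hmap s')).sub ((hF s hs).1.pullback (hmap s)))
      have h2 : β.pullback (H s) - β.pullback (H 0) + (β.pullback (H s') - β.pullback (H s)) =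
        β.pullback (H s') - β.pullback (H 0) := by abel
      rw [h2] at h1
      exact h1.congr ((hF s hs).2 s' hs')
    filter_upwards [Metric.ball_mem_nhds t hε] with s hs
    exact propext ⟨himp s hs t (Metric.mem_ball_self hε), himp t (Metric.mem_ball_self hε) s hs⟩
  have hone : ∀ x, (β.pullback (H 1) - β.pullback (H 0)).IsPrimitiveNear (Φ 1) x := by
    intro x
    have h0 : (β.pullback (H 0) - β.pullback (H 0)).IsPrimitiveNear (Φ 0) x := by
      rw [sub_self]
      refine OneForm.IsPrimitiveNear.zero.congr (Eventually.of_forall fun y => ?_)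
      simp [hΦ]
    exact ((hlc x).apply_eq_of_preconnectedSpace 0 1).mp h0
  exact ⟨Φ 1, fun x => (hone x).self_of_nhds.1, funext fun x => (hone x).self_of_nhds.2⟩

end Homotopy

/-! ### Connected groups act trivially on cohomology -/

section ConnectedGroup

variable {m n : ℕ} {G : Type*} [TopologicalSpace G] [Group G] {M : Type*} [TopologicalSpace M]

/-- A segment in a chart at `1`, reparametrized by `Real.smoothTransition` so that the path is
smooth on the whole line and never leaves the chart. -/
theorem eventually_exists_smooth_path [ChartedSpace (EuclideanSpace ℝ (Fin m)) G]
    [LieGroup (𝓡 m) ∞ G] :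
    ∀ᶠ a in 𝓝 (1 : G), ∃ γ : ℝ → G, ContMDiff 𝓘(ℝ, ℝ) (𝓡 m) ∞ γ ∧ γ 0 = 1 ∧ γ 1 = a := by
  set e := chartAt (EuclideanSpace ℝ (Fin m)) (1 : G) with he
  have h1 : (1 : G) ∈ e.source := mem_chart_source _ _
  obtain ⟨r, hr, hball⟩ := Metric.isOpen_iff.1 e.open_target (e 1) (e.map_source h1)
  filter_upwards [e.open_source.mem_nhds h1,
    (e.continuousAt h1).preimage_mem_nhds (Metric.ball_mem_nhds _ hr)] with a ha hab
  have hmem : ∀ t, e 1 + Real.smoothTransition t • (e a - e 1) ∈ e.target := fun t =>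
    hball ((convex_ball (e 1) r).add_smul_sub_mem (Metric.mem_ball_self hr) hab
      ⟨Real.smoothTransition.nonneg t, Real.smoothTransition.le_one t⟩)
  refine ⟨fun t => e.symm (e 1 + Real.smoothTransition t • (e a - e 1)), ?_, ?_, ?_⟩
  · intro t
    refine ContMDiffAt.comp t (I' := 𝓡 m) (g := e.symm)
      ((contMDiffOn_chart_symm (I := 𝓡 m) (n := ∞) (x := (1 : G))).contMDiffAt
        (e.open_target.mem_nhds (hmem t))) ?_
    rw [contMDiffAt_iff_contDiffAt]
    exact contDiffAt_const.add (Real.smoothTransition.contDiff.contDiffAt.smul contDiffAt_const)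
  · simp [e.left_inv h1]
  · simp [e.left_inv ha]

variable [MulAction G M]

theorem contMDiff_const_smul' (m n : ℕ) [ChartedSpace (EuclideanSpace ℝ (Fin m)) G]
    [ChartedSpace (EuclideanSpace ℝ (Fin n)) M] [ContMDiffSMul (𝓡 m) (𝓡 n) ∞ G M] (a : G) :
    ContMDiff (𝓡 n) (𝓡 n) ∞ (fun x : M => a • x) :=
  (ContMDiffSMul.contMDiff_smul (I := 𝓡 m) (I' := 𝓡 n) (n := ∞) (G := G) (M := M)).comp
    (contMDiff_const.prodMk contMDiff_id)

theorem contMDiff_smul_const (m n : ℕ) [ChartedSpace (EuclideanSpace ℝ (Fin m)) G]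
    [ChartedSpace (EuclideanSpace ℝ (Fin n)) M] [ContMDiffSMul (𝓡 m) (𝓡 n) ∞ G M] (x : M) :
    ContMDiff (𝓡 m) (𝓡 n) ∞ (fun a : G => a • x) :=
  (ContMDiffSMul.contMDiff_smul (I := 𝓡 m) (I' := 𝓡 n) (n := ∞) (G := G) (M := M)).comp
    (contMDiff_id.prodMk contMDiff_const)

/-- The action of a connected group does not change the cohomology class of a closed 1-form. -/
theorem OneForm.LocallyExact.exists_pullback_smul_sub (m : ℕ)
    [ChartedSpace (EuclideanSpace ℝ (Fin m)) G] [ChartedSpace (EuclideanSpace ℝ (Fin n)) M]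
    [ContMDiffSMul (𝓡 m) (𝓡 n) ∞ G M] [LieGroup (𝓡 m) ∞ G] [ConnectedSpace G]
    {β : OneForm n M} (hβ : β.LocallyExact) (a : G) :
    ∃ Φ : M → ℝ, ContMDiff (𝓡 n) 𝓘(ℝ, ℝ) ∞ Φ ∧
      β.pullback (fun x => a • x) - β = dFun Φ := by
  have hs := fun a : G => contMDiff_const_smul' m n (M := M) a
  have hd := fun a : G => (hs a).mdifferentiable (by simp)
  have : IsTopologicalGroup G := topologicalGroup_of_lieGroup (𝓡 m) ∞
  -- The elements that fix the class of `β` form a subgroup. By homotopy invariance along smooth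
  -- paths from `1` it contains a neighbourhood of `1`, so it is open and closed, hence all of the
  -- connected group.
  let S : Subgroup G :=
    { carrier := {a | ∃ Φ : M → ℝ, ContMDiff (𝓡 n) 𝓘(ℝ, ℝ) ∞ Φ ∧
        β.pullback (fun x => a • x) - β = dFun Φ}
      mul_mem' := by
        rintro a b ⟨Φ, hΦ, ha⟩ ⟨Ψ, hΨ, hb⟩
        refine ⟨Φ ∘ (fun x => b • x) + Ψ, (hΦ.comp (hs b)).add hΨ, ?_⟩
        have hab : (fun x : M => (a * b) • x) = (fun x => a • x) ∘ fun x => b • x := by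
          funext x
          exact mul_smul a b x
        have h1 : β.pullback (fun x : M => (a * b) • x) - β =
            (β.pullback (fun x : M => a • x) - β).pullback (fun x : M => b • x) +
              (β.pullback (fun x : M => b • x) - β) := by
          rw [OneForm.pullback_sub, hab, OneForm.pullback_comp β (hd a) (hd b)]
          abel
        rw [h1, ha, hb, OneForm.pullback_dFun (hΦ.mdifferentiable (by simp)) (hd b)]
        funext x
        exact (mvfderiv_add ((hΦ.comp (hs b)).mdifferentiable (by simp) x)
          (hΨ.mdifferentiable (by simp) x)).symm
      one_mem' := by
        refine ⟨fun _ => 0, contMDiff_const, ?_⟩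
        have h1 : (fun x : M => (1 : G) • x) = id := by
          funext x
          exact one_smul G x
        rw [h1, OneForm.pullback_id, sub_self]
        funext x
        exact (mvfderiv_const (0 : ℝ)).symm
      inv_mem' := by
        rintro a ⟨Φ, hΦ, ha⟩
        refine ⟨-(Φ ∘ fun x => a⁻¹ • x), (hΦ.comp (hs a⁻¹)).neg, ?_⟩
        have h1 := congrArg (OneForm.pullback fun x : M => a⁻¹ • x) ha
        have hab : (fun x : M => a • x) ∘ (fun x => a⁻¹ • x) = id := by
          funext x
          exact smul_inv_smul a x
        rw [OneForm.pullback_sub, ← OneForm.pullback_comp β (hd a) (hd a⁻¹), hab,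
          OneForm.pullback_id,
          OneForm.pullback_dFun (hΦ.mdifferentiable (by simp)) (hd a⁻¹)] at h1
        rw [← neg_sub, h1]
        funext x
        exact mvfderiv_neg.symm }
  have hnhds : (S : Set G) ∈ 𝓝 (1 : G) := by
    filter_upwards [eventually_exists_smooth_path (m := m) (G := G)] with b hb
    obtain ⟨γ, hγ, h0, h1⟩ := hb
    have hH : ContMDiff (𝓘(ℝ, ℝ).prod (𝓡 n)) (𝓡 n) ∞ (fun p : ℝ × M => γ p.1 • p.2) :=
      (ContMDiffSMul.contMDiff_smul (I := 𝓡 m) (I' := 𝓡 n) (n := ∞) (G := G) (M := M)).comp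
        ((hγ.comp contMDiff_fst).prodMk contMDiff_snd)
    obtain ⟨Φ, hΦ, hdΦ⟩ := hβ.exists_homotopy_primitive (H := fun t x => γ t • x) hH
    refine ⟨Φ, hΦ, ?_⟩
    rw [← hdΦ, h0, h1]
    congr 1
    have : (fun x : M => (1 : G) • x) = id := by
      funext x
      exact one_smul G x
    rw [this, OneForm.pullback_id]
  have hopen : IsOpen (S : Set G) := S.isOpen_of_mem_nhds hnhds
  have huniv : (S : Set G) = univ :=
    IsClopen.eq_univ ⟨S.isClosed_of_isOpen hopen, hopen⟩ ⟨1, S.one_mem⟩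
  have : a ∈ (S : Set G) := huniv ▸ mem_univ a
  exact this

end ConnectedGroup

/-! ### Inner products of 1-forms, isometries and harmonic forms -/

section Sharp

variable {n : ℕ} {M : Type*} [TopologicalSpace M] [ChartedSpace (EuclideanSpace ℝ (Fin n)) M]
  [IsManifold (𝓡 n) ∞ M]

theorem Metric.eq_zero_of_inner_self (g : Metric n M) {x : M} {v : TangentSpace (𝓡 n) x}
    (h : g.inner x v v = 0) : v = 0 := by
  by_contra hne
  exact (g.pos x v hne).ne' h

theorem sharp_eq_of_forall (g : Metric n M) {x : M} {a : TangentSpace (𝓡 n) x →L[ℝ] ℝ}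
    {v : TangentSpace (𝓡 n) x} (h : ∀ w, g.inner x v w = a w) : sharp g x a = v := by
  rw [← sub_eq_zero]
  have key : ∀ w, g.inner x (sharp g x a - v) w = 0 := fun w => by simp [sharp_spec, h]
  exact g.eq_zero_of_inner_self (key _)

theorem formInner_eq_apply_sharp (g : Metric n M) (α β : OneForm n M) (x : M) :
    formInner g α β x = α x (sharp g x (β x)) :=
  sharp_spec g x (α x) _

theorem formInner_comm (g : Metric n M) (α β : OneForm n M) (x : M) :
    formInner g α β x = formInner g β α x :=
  g.symm x _ _

theorem formInner_self_eq_zero_iff (g : Metric n M) (α : OneForm n M) (x : M) :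
    formInner g α α x = 0 ↔ α x = 0 := by
  constructor
  · intro h
    have h0 := g.eq_zero_of_inner_self h
    ext w
    rw [← sharp_spec g x (α x) w, h0]
    simp
  · intro h
    rw [formInner_eq_apply_sharp, h]
    rfl

theorem formInner_self_nonneg (g : Metric n M) (α : OneForm n M) (x : M) :
    0 ≤ formInner g α α x := by
  by_cases h : sharp g x (α x) = 0
  · rw [formInner, h]
    simp
  · exact (g.pos x _ h).le

end Sharp

section Invariance

variable {n : ℕ} {M : Type*} [TopologicalSpace M] [ChartedSpace (EuclideanSpace ℝ (Fin n)) M]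
  [IsManifold (𝓡 n) ∞ M] {G : Type*} [Group G] [MulAction G M]

/-- An isometry intertwines the two musical isomorphisms. Its derivative is injective because it
preserves the metric, hence surjective by dimension, so the dual vector can be tested on its image.
-/
theorem formInner_pullback_smul {g : Metric n M} {a : G}
    (hg : ∀ (x : M) (u v : TangentSpace (𝓡 n) x),
      g.inner (a • x) (actionDeriv a x u) (actionDeriv a x v) = g.inner x u v)
    (α β : OneForm n M) (x : M) :
    formInner g (α.pullback fun x => a • x) (β.pullback fun x => a • x) x =
      formInner g α β (a • x) := by
  have hinj : Function.Injective (actionDeriv (n := n) a x) := by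
    rw [injective_iff_map_eq_zero]
    intro u hu
    refine g.eq_zero_of_inner_self ?_
    rw [← hg, hu]
    simp
  let T : EuclideanSpace ℝ (Fin n) →L[ℝ] EuclideanSpace ℝ (Fin n) := actionDeriv (n := n) a x
  have hsurj : Function.Surjective (actionDeriv (n := n) a x) :=
    (LinearMap.injective_iff_surjective (f := T.toLinearMap)).1 hinj
  have hsharp : sharp g (a • x) (β (a • x)) =
      actionDeriv a x (sharp g x (β.pullback (fun x => a • x) x)) := by
    refine sharp_eq_of_forall g fun w => ?_
    obtain ⟨w, rfl⟩ := hsurj w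
    rw [hg, sharp_spec]
    rfl
  rw [formInner_eq_apply_sharp, formInner_eq_apply_sharp, hsharp]
  rfl

end Invariance

section Harmonic

variable {m n : ℕ} {G : Type*} [TopologicalSpace G] [ChartedSpace (EuclideanSpace ℝ (Fin m)) G]
  [Group G] {M : Type*} [TopologicalSpace M] [ChartedSpace (EuclideanSpace ℝ (Fin n)) M]
  [IsManifold (𝓡 n) ∞ M] [MeasurableSpace M]

theorem IsL2Harmonic.locallyExact {g : Metric n M} {lam : Measure M} {χ : OneForm n M}
    (h : IsL2Harmonic g lam χ) : χ.LocallyExact :=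
  h.smooth.locallyExact h.closed

theorem HasUniqueHarmonicRepresentatives.eq {g : Metric n M} {lam : Measure M}
    (hrep : HasUniqueHarmonicRepresentatives g lam) {χ χ' : OneForm n M}
    (hχ : IsL2Harmonic g lam χ) (hχ' : IsL2Harmonic g lam χ') {F : M → ℝ}
    (hF : ContMDiff (𝓡 n) 𝓘(ℝ, ℝ) ∞ F) (h : χ - χ' = dFun F) : χ = χ' := by
  let c : ClosedOneForm n M := ⟨χ, hχ.smooth, hχ.closed⟩
  let c' : ClosedOneForm n M := ⟨χ', hχ'.smooth, hχ'.closed⟩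
  have hcc : c.class = c'.class := Quotient.sound (s := cohomologous n M) ⟨F, hF, h⟩
  exact congrArg Subtype.val ((hrep c'.class).unique (y₁ := c) (y₂ := c') ⟨hcc, hχ⟩ ⟨rfl, hχ'⟩)

variable [BorelSpace M] [MulAction G M]

theorem IsL2Harmonic.pullback_smul (m : ℕ) [ChartedSpace (EuclideanSpace ℝ (Fin m)) G]
    [ContMDiffSMul (𝓡 m) (𝓡 n) ∞ G M] {g : Metric n M} {lam : Measure M} {a : G}
    (hg : ∀ (x : M) (u v : TangentSpace (𝓡 n) x),
      g.inner (a • x) (actionDeriv a x u) (actionDeriv a x v) = g.inner x u v)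
    (hlam : MeasurePreserving (fun x : M => a • x) lam lam)
    {χ : OneForm n M} (hχ : IsL2Harmonic g lam χ) :
    IsL2Harmonic g lam (χ.pullback fun x => a • x) := by
  have hs := fun b : G => contMDiff_const_smul' m n (M := M) b
  have hex := hχ.locallyExact.pullback (hs a)
  let e : M ≃ₜ M :=
    { toFun := fun x => a • x
      invFun := fun x => a⁻¹ • x
      left_inv := fun x => inv_smul_smul a x
      right_inv := fun x => smul_inv_smul a x
      continuous_toFun := (hs a).continuous
      continuous_invFun := (hs a⁻¹).continuous }
  refine ⟨hex.isSmooth, hex.isClosed, ?_, ?_⟩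
  · intro φ hφ hφc
    have hψ : ContMDiff (𝓡 n) 𝓘(ℝ, ℝ) ∞ (φ ∘ e.symm) := hφ.comp (hs a⁻¹)
    -- Writing `dφ` as a pullback by `a` moves the integral to the test function `φ ∘ a⁻¹`, by
    -- invariance of `lam`.
    have hback : (dFun φ : OneForm n M) = OneForm.pullback (fun x => a • x) (dFun (φ ∘ e.symm)) := by
      rw [OneForm.pullback_dFun (hψ.mdifferentiable (by simp)) ((hs a).mdifferentiable (by simp))]
      congr 1
      funext x
      exact congrArg φ (e.left_inv x).symm
    rw [hback]
    simp_rw [formInner_pullback_smul hg]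
    have h1 := hlam.integral_comp (g := formInner g χ (dFun (φ ∘ e.symm))) e.measurableEmbedding
    rw [h1, hχ.coclosed _ hψ (hφc.comp_homeomorph e.symm)]
    simp
  · have h1 : (fun x => Real.sqrt (formInner g (χ.pullback fun x => a • x)
        (χ.pullback fun x => a • x) x)) =
        (fun x => Real.sqrt (formInner g χ χ x)) ∘ fun x => a • x := by
      funext x
      rw [formInner_pullback_smul hg]
      rfl
    rw [OneForm.MemL2, h1]
    exact MemLp.comp_measurePreserving hχ.memL2 hlam

end Harmonic

/-! ### Invariant closed 1-forms on the generators -/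

section Generators

variable {m n : ℕ} {G : Type*} [TopologicalSpace G] [ChartedSpace (EuclideanSpace ℝ (Fin m)) G]
  [Group G] {M : Type*} [TopologicalSpace M] [ChartedSpace (EuclideanSpace ℝ (Fin n)) M]
  [MulAction G M]

theorem infGen_eq_zero_of_fixed (ξ : LieAlg m G) {y : M} (hy : ∀ a : G, a • y = y) :
    infGen (n := n) ξ y = 0 := by
  have h : (fun a : G => a • y) = fun _ => y := funext hy
  have h1 : ∀ f : G → M, f = (fun _ => y) →
      (mfderiv (𝓡 m) (𝓡 n) f 1 : EuclideanSpace ℝ (Fin m) → EuclideanSpace ℝ (Fin n)) ξ = 0 := by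
    rintro f rfl
    rw [mfderiv_const]
    rfl
  exact h1 _ h

variable [ContMDiffSMul (𝓡 m) (𝓡 n) ∞ G M]

theorem dFun_infGen {F : M → ℝ} {y : M} (hF : MDifferentiableAt (𝓡 n) 𝓘(ℝ, ℝ) F y)
    (ξ : LieAlg m G) : (mfderiv (𝓡 m) 𝓘(ℝ, ℝ) (fun a : G => F (a • y)) 1 ξ : ℝ) =
      (dFun F y : TangentSpace (𝓡 n) y →L[ℝ] ℝ) (infGen ξ y) := by
  have h1 := mfderiv_comp_of_eq (I := 𝓡 m) (f := fun a : G => a • y) (x := 1) hF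
    ((contMDiff_smul_const m n y).mdifferentiable (by simp) (1 : G)) (one_smul G y)
  have h2 : ∀ z : M, z = y → ∀ v : EuclideanSpace ℝ (Fin n),
      (mfderiv (𝓡 n) 𝓘(ℝ, ℝ) F z : EuclideanSpace ℝ (Fin n) → ℝ) v =
      (mfderiv (𝓡 n) 𝓘(ℝ, ℝ) F y : EuclideanSpace ℝ (Fin n) → ℝ) v := by
    rintro z rfl v
    rfl
  have h3 := DFunLike.congr_fun h1 ξ
  exact h3.trans (h2 _ (one_smul G y) _)

variable [IsManifold (𝓡 n) ∞ M]

/-- For a local primitive `F` and `a` near `1`, invariance says that `y ↦ F (a • y) - F y` has zero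
differential, so it does not depend on `y` in a small connected neighbourhood. Differentiating in
`a` at `1` gives the claim. -/
theorem OneForm.LocallyExact.isLocallyConstant_apply_infGen {χ : OneForm n M}
    (hχ : χ.LocallyExact) (hinv : ∀ a : G, χ.pullback (fun x => a • x) = χ) (ξ : LieAlg m G) :
    IsLocallyConstant fun x : M => (χ x (infGen ξ x) : ℝ) := by
  have : LocallyConnectedSpace M :=
    ChartedSpace.locallyConnectedSpace (EuclideanSpace ℝ (Fin n)) M
  rw [IsLocallyConstant.iff_eventually_eq]
  intro x
  obtain ⟨F, hF⟩ := hχ x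
  have hcont : Tendsto (fun p : G × M => p.1 • p.2) (𝓝 1 ×ˢ 𝓝 x) (𝓝 x) := by
    have := (ContMDiffSMul.contMDiff_smul (I := 𝓡 m) (I' := 𝓡 n) (n := ∞) (G := G)
      (M := M)).continuous.continuousAt (x := ((1 : G), x))
    rwa [ContinuousAt, one_smul, nhds_prod_eq] at this
  obtain ⟨p, hp, q, hq, hpq⟩ := Filter.eventually_prod_iff.1 (hcont.eventually hF.eventually)
  obtain ⟨W, hWq, hWo, hxW, hWc⟩ := locallyConnectedSpace_iff_subsets_isOpen_isConnected.1 this x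
    {y | q y} hq
  have hprim : ∀ y ∈ W, χ.IsPrimitiveNear F y := fun y hy => by
    simpa using hpq hp.self_of_nhds (hWq hy)
  -- `W` need not be invariant: it suffices that `a • y` stays in the domain of `F` for `a` near
  -- `1`. This set of `a` is independent of `y ∈ W`.
  have hconst : ∀ a, p a → ∀ y ∈ W, F (a • y) - F y = F (a • x) - F x := by
    intro a ha y hy
    have hW : IsLocallyConstant fun w : W => F (a • (w : M)) - F w := by
      rw [IsLocallyConstant.iff_eventually_eq]
      intro w
      have h0 : (0 : OneForm n M).IsPrimitiveNear ((F ∘ fun x => a • x) - F) (w : M) := by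
        have h1 := (((hpq ha (hWq w.2)).pullback (φ := fun x => a • x)
          (contMDiff_const_smul' m n a)).sub (hprim w w.2))
        rwa [hinv a, sub_self] at h1
      have h2 := eventually_eq_of_dFun_eq_zero (F := (F ∘ fun x => a • x) - F) (x := (w : M)) (by
        filter_upwards [h0] with z hz using ⟨hz.1.mdifferentiableAt (by simp), hz.2.symm⟩)
      exact continuous_subtype_val.continuousAt.eventually h2
    have := isPreconnected_iff_preconnectedSpace.1 hWc.isPreconnected
    exact hW.apply_eq_of_preconnectedSpace ⟨y, hy⟩ ⟨x, hxW⟩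
  filter_upwards [hWo.mem_nhds hxW] with y hy
  have hd : ∀ z ∈ W, (χ z (infGen ξ z) : ℝ) =
      (mfderiv (𝓡 m) 𝓘(ℝ, ℝ) (fun a : G => F (a • z)) 1 ξ : ℝ) := by
    intro z hz
    rw [dFun_infGen ((hprim z hz).self_of_nhds.1.mdifferentiableAt (by simp)),
      (hprim z hz).self_of_nhds.2]
  rw [hd y hy, hd x hxW]
  have hev : (fun a : G => F (a • y)) =ᶠ[𝓝 1] (fun a => F (a • x)) + fun _ => (F y - F x) := by
    filter_upwards [hp] with a ha
    have := hconst a ha y hy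
    simp only [Pi.add_apply]
    linarith
  have hmd : MDifferentiableAt (𝓡 m) 𝓘(ℝ, ℝ) (fun a : G => F (a • x)) 1 := by
    have h1 : MDifferentiableAt (𝓡 n) 𝓘(ℝ, ℝ) F ((1 : G) • x) := by
      rw [one_smul]
      exact (hprim x hxW).self_of_nhds.1.mdifferentiableAt (by simp)
    exact h1.comp (1 : G) ((contMDiff_smul_const m n x).mdifferentiable (by simp) (1 : G))
  have h5 : (mvfderiv (𝓡 m) (fun a : G => F (a • y)) 1) =
      mvfderiv (𝓡 m) ((fun a : G => F (a • x)) + fun _ => (F y - F x)) 1 := hev.mfderiv_eq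
  rw [mvfderiv_add hmd mdifferentiableAt_const, mvfderiv_const, add_zero] at h5
  exact DFunLike.congr_fun h5 ξ

/-- An invariant closed 1-form vanishes on the generators of an action with fixed points. -/
theorem OneForm.LocallyExact.apply_infGen_eq_zero {χ : OneForm n M}
    (hχ : χ.LocallyExact) (hinv : ∀ a : G, χ.pullback (fun x => a • x) = χ)
    (hfix : ∀ x : M, ∃ y ∈ connectedComponent x, ∀ a : G, a • y = y) (ξ : LieAlg m G) (x : M) :
    χ x (infGen ξ x) = 0 := by
  obtain ⟨y, hy, hfy⟩ := hfix x
  have h := (hχ.isLocallyConstant_apply_infGen hinv ξ).apply_eq_of_isPreconnected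
    isPreconnected_connectedComponent hy mem_connectedComponent
  refine h.symm.trans ?_
  rw [infGen_eq_zero_of_fixed ξ hfy, map_zero]

end Generators

/-! ### Exterior derivative of 2-forms on a vector space -/

section AlternatingDegreeTwo

variable {E : Type*} [NormedAddCommGroup E] [NormedSpace ℝ E]

/-- Alternating forms of degree two, seen as bilinear forms. -/
noncomputable def altTwo (E : Type*) [NormedAddCommGroup E] [NormedSpace ℝ E]
    (f : E [⋀^Fin 2]→L[ℝ] ℝ) : E →L[ℝ] E →L[ℝ] ℝ :=
  ((altOne E).symm.toContinuousLinearEquiv : (E [⋀^Fin 1]→L[ℝ] ℝ) →L[ℝ] (E →L[ℝ] ℝ)).comp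
    f.curryLeft

theorem altTwo_apply (f : E [⋀^Fin 2]→L[ℝ] ℝ) (u v : E) : altTwo E f u v = f ![u, v] := by
  change (altOne E (altTwo E f u)) (fun _ => v) = _
  have h : altOne E (altTwo E f u) = f.curryLeft u := (altOne E).apply_symm_apply _
  rw [h, ContinuousAlternatingMap.curryLeft_apply_apply]
  congr 1
  funext i
  fin_cases i <;> rfl

theorem contDiff_altTwo : ContDiff ℝ ∞ (altTwo E) := by
  refine (IsLinearMap.with_bound (𝕜 := ℝ) (f := altTwo E) ⟨fun f f' => ?_, fun c f => ?_⟩ 1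
    fun f => ?_).contDiff
  · ext u v
    simp [altTwo_apply]
  · ext u v
    simp [altTwo_apply]
  · refine ContinuousLinearMap.opNorm_le_bound₂ _ (by positivity) fun u v => ?_
    rw [altTwo_apply]
    refine (f.le_opNorm _).trans_eq ?_
    simp [Fin.prod_univ_two, mul_assoc]

theorem altTwo_swap (f : E [⋀^Fin 2]→L[ℝ] ℝ) (u v : E) : altTwo E f u v = -altTwo E f v u := by
  rw [altTwo_apply, altTwo_apply]
  have h := f.map_swap ![v, u] (i := 0) (j := 1) (by simp)
  refine Eq.trans (congrArg f ?_) h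
  funext i
  fin_cases i <;> rfl

theorem extDeriv_two_apply {θ : E → E [⋀^Fin 2]→L[ℝ] ℝ} {y : E} (h : DifferentiableAt ℝ θ y)
    (p q r : E) :
    extDeriv θ y ![p, q, r] = fderiv ℝ (fun z => altTwo E (θ z)) y p q r -
      fderiv ℝ (fun z => altTwo E (θ z)) y q p r + fderiv ℝ (fun z => altTwo E (θ z)) y r p q := by
  have hd : DifferentiableAt ℝ (fun z => altTwo E (θ z)) y :=
    (contDiff_altTwo.differentiable (by simp) _).comp y h
  have hd1 : ∀ s t w : E, fderiv ℝ (fun z => θ z ![s, t]) y w =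
      fderiv ℝ (fun z => altTwo E (θ z)) y w s t := by
    intro s t w
    simp_rw [← altTwo_apply]
    have h2 := ((hd.hasFDerivAt.clm_apply (hasFDerivAt_const s y)).clm_apply
      (hasFDerivAt_const t y)).fderiv
    rw [h2]
    simp
  have e0 : (0 : Fin 3).removeNth ![p, q, r] = ![q, r] := by
    funext i; fin_cases i <;> rfl
  have e1 : (1 : Fin 3).removeNth ![p, q, r] = ![p, r] := by
    funext i; fin_cases i <;> rfl
  have e2 : (2 : Fin 3).removeNth ![p, q, r] = ![p, q] := by
    funext i; fin_cases i <;> rfl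
  rw [extDeriv_apply h, Fin.sum_univ_three, e0, e1, e2, hd1, hd1, hd1]
  simp [sub_eq_add_neg]

end AlternatingDegreeTwo

/-! ### Cartan's formula for a local flow in coordinates -/

section LocalFlow

variable {E : Type*} [NormedAddCommGroup E] [NormedSpace ℝ E]

theorem contDiffAt_flow_generator {A : ℝ × E → E} {y : E} (hA : ContDiffAt ℝ ∞ A (0, y)) :
    ContDiffAt ℝ ∞ (fun z => fderiv ℝ A (0, z) (1, 0)) y := by
  have h1 : ContDiffAt ℝ ∞ (fderiv ℝ A) (0, y) := hA.fderiv_right (by simp)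
  have h2 : ContDiffAt ℝ ∞ (fun z : E => ((0 : ℝ), z)) y := contDiffAt_const.prodMk contDiffAt_id
  exact (ContDiffAt.comp y h1 h2).clm_apply contDiffAt_const

theorem hasFDerivAt_flow_generator {A : ℝ × E → E} {y : E} (hA : ContDiffAt ℝ ∞ A (0, y)) :
    HasFDerivAt (fun z => fderiv ℝ A (0, z) (1, 0))
      (fderiv ℝ (fun z => fderiv ℝ A (0, z) (1, 0)) y) y :=
  ((contDiffAt_flow_generator hA).differentiableAt (by simp)).hasFDerivAt

theorem fderiv_flow_id {A : ℝ × E → E} {y : E} (hA : ContDiffAt ℝ ∞ A (0, y))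
    (hA0 : ∀ᶠ z in 𝓝 y, A (0, z) = z) (w : E) : fderiv ℝ A (0, y) (0, w) = w := by
  have hAd : HasFDerivAt A (fderiv ℝ A (0, y)) (0, y) :=
    (hA.differentiableAt (by simp)).hasFDerivAt
  have h1 : HasFDerivAt (fun z => A ((0 : ℝ), z)) ((fderiv ℝ A (0, y)).comp
      (ContinuousLinearMap.inr ℝ ℝ E)) y :=
    HasFDerivAt.comp y hAd (hasFDerivAt_prodMk_right (0 : ℝ) y)
  have h2 : HasFDerivAt (fun z => A ((0 : ℝ), z)) (ContinuousLinearMap.id ℝ E) y :=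
    (hasFDerivAt_id y).congr_of_eventuallyEq hA0
  exact DFunLike.congr_fun (h1.unique h2) w

theorem fderiv_snd_apply {F : Type*} [NormedAddCommGroup F] [NormedSpace ℝ F]
    {Φ : ℝ × E → F →L[ℝ] E} {Φ' : ℝ × E →L[ℝ] F →L[ℝ] E} {y : E} (h : HasFDerivAt Φ Φ' (0, y))
    (p : F) (w : E) : fderiv ℝ (fun z => Φ (0, z) p) y w = Φ' (0, w) p := by
  have h1 : HasFDerivAt (fun z => Φ (0, z)) (Φ'.comp (ContinuousLinearMap.inr ℝ ℝ E)) y :=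
    HasFDerivAt.comp y h (hasFDerivAt_prodMk_right (0 : ℝ) y)
  rw [(h1.clm_apply (hasFDerivAt_const p y)).fderiv]
  simp

theorem hasDerivAt_fst_apply {F : Type*} [NormedAddCommGroup F] [NormedSpace ℝ F]
    {Φ : ℝ × E → F →L[ℝ] E} {Φ' : ℝ × E →L[ℝ] F →L[ℝ] E} {y : E} (h : HasFDerivAt Φ Φ' (0, y))
    (p : F) : HasDerivAt (fun t => Φ (t, y) p) (Φ' (1, 0) p) 0 := by
  have hcurve : HasDerivAt (fun t : ℝ => (t, y)) ((1 : ℝ), (0 : E)) 0 :=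
    (hasDerivAt_id (0 : ℝ)).prodMk (hasDerivAt_const (0 : ℝ) y)
  have h1 : HasDerivAt (fun t => Φ (t, y)) (Φ' (1, 0)) 0 := h.comp_hasDerivAt 0 hcurve
  simpa using h1.clm_apply (hasDerivAt_const (0 : ℝ) p)

/-- Symmetry of second derivatives: the time derivative of the spatial derivative of the flow is the
spatial derivative of its generator. -/
theorem hasDerivAt_flow_fderiv {A : ℝ × E → E} {y : E} (hA : ContDiffAt ℝ ∞ A (0, y)) (w : E) :
    HasDerivAt (fun t => fderiv ℝ A (t, y) (0, w))
      (fderiv ℝ (fun z => fderiv ℝ A (0, z) (1, 0)) y w) 0 := by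
  have hA2 : HasFDerivAt (fderiv ℝ A) (fderiv ℝ (fderiv ℝ A) (0, y)) (0, y) :=
    ((hA.fderiv_right (m := ∞) (by simp)).differentiableAt (by simp)).hasFDerivAt
  have hsymm := (hA.isSymmSndFDerivAt (by simpa using ENat.LEInfty.out)) (1, 0) (0, w)
  rw [fderiv_snd_apply hA2, ← hsymm]
  exact hasDerivAt_fst_apply hA2 _

/-- The derivative of the identity which expresses that a local flow preserves the field `b` of
bilinear forms. -/
theorem flow_invariance_deriv {A : ℝ × E → E} {y : E} (hA : ContDiffAt ℝ ∞ A (0, y))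
    (hA0 : ∀ᶠ z in 𝓝 y, A (0, z) = z) {b : E → E →L[ℝ] E →L[ℝ] ℝ}
    {b' : E →L[ℝ] E →L[ℝ] E →L[ℝ] ℝ} (hb : HasFDerivAt b b' y)
    (hinv : ∀ᶠ t in 𝓝 (0 : ℝ), ∀ u v, b (A (t, y)) (fderiv ℝ A (t, y) (0, u))
      (fderiv ℝ A (t, y) (0, v)) = b y u v) (u v : E) :
    b' (fderiv ℝ A (0, y) (1, 0)) u v +
      b y (fderiv ℝ (fun z => fderiv ℝ A (0, z) (1, 0)) y u) v +
      b y u (fderiv ℝ (fun z => fderiv ℝ A (0, z) (1, 0)) y v) = 0 := by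
  have hcurve : HasDerivAt (fun t : ℝ => (t, y)) ((1 : ℝ), (0 : E)) 0 :=
    (hasDerivAt_id (0 : ℝ)).prodMk (hasDerivAt_const (0 : ℝ) y)
  have hy0 : A (0, y) = y := hA0.self_of_nhds
  have h1 : HasDerivAt (fun t => A (t, y)) (fderiv ℝ A (0, y) (1, 0)) 0 :=
    (hA.differentiableAt (by simp)).hasFDerivAt.comp_hasDerivAt 0 hcurve
  have h2 : HasDerivAt (fun t => b (A (t, y))) (b' (fderiv ℝ A (0, y) (1, 0))) 0 := by
    refine HasFDerivAt.comp_hasDerivAt (l := b) 0 ?_ h1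
    rw [hy0]
    exact hb
  -- The product rule for the pulled back form at time `0`. The three terms are those of the Lie
  -- derivative, and they sum to zero because the pullback is constant in time.
  have h4 := (h2.clm_apply (hasDerivAt_flow_fderiv hA u)).clm_apply (hasDerivAt_flow_fderiv hA v)
  have h5 : HasDerivAt (fun t => b (A (t, y)) (fderiv ℝ A (t, y) (0, u))
      (fderiv ℝ A (t, y) (0, v))) 0 0 := by
    refine (hasDerivAt_const (0 : ℝ) (b y u v)).congr_of_eventuallyEq ?_
    filter_upwards [hinv] with t ht using ht u v
  have h6 := h4.unique h5
  rw [fderiv_flow_id hA hA0, fderiv_flow_id hA hA0, hy0] at h6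
  exact h6

/-- If a local flow preserves a closed 2-form, then the contraction of the form with the generator
of the flow is closed. -/
theorem fderiv_contraction_symm {A : ℝ × E → E} {y : E} (hA : ContDiffAt ℝ ∞ A (0, y))
    (hA0 : ∀ᶠ z in 𝓝 y, A (0, z) = z) {b : E → E →L[ℝ] E →L[ℝ] ℝ}
    {b' : E →L[ℝ] E →L[ℝ] E →L[ℝ] ℝ} (hb : HasFDerivAt b b' y)
    (hskew : ∀ u v, b y u v = -b y v u)
    (hclosed : ∀ p q r, b' p q r - b' q p r + b' r p q = 0)
    (hinv : ∀ᶠ t in 𝓝 (0 : ℝ), ∀ u v, b (A (t, y)) (fderiv ℝ A (t, y) (0, u))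
      (fderiv ℝ A (t, y) (0, v)) = b y u v) (u v : E) :
    fderiv ℝ (fun z => b z (fderiv ℝ A (0, z) (1, 0))) y u v =
      fderiv ℝ (fun z => b z (fderiv ℝ A (0, z) (1, 0))) y v u := by
  have h2 := hb.clm_apply (hasFDerivAt_flow_generator hA)
  have hα : ∀ w z, fderiv ℝ (fun z => b z (fderiv ℝ A (0, z) (1, 0))) y w z =
      b' w (fderiv ℝ A (0, y) (1, 0)) z +
        b y (fderiv ℝ (fun z => fderiv ℝ A (0, z) (1, 0)) y w) z := by
    intro w z
    rw [h2.fderiv]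
    simp [add_comm]
  -- With `X` the generator, `d(ι_X b) = L_X b - ι_X db`: `hflow` says that the first term vanishes,
  -- and `hext`, which is `db = 0` with `X` in the first slot, that the second does.
  have hflow := flow_invariance_deriv hA hA0 hb hinv u v
  have hext := hclosed (fderiv ℝ A (0, y) (1, 0)) u v
  rw [hα, hα]
  rw [hskew u] at hflow
  linarith

end LocalFlow

/-! ### The group action in charts -/

section Curve

variable {m : ℕ} {G : Type*} [TopologicalSpace G] [ChartedSpace (EuclideanSpace ℝ (Fin m)) G]
  [Group G]

/-- This curve takes the place of `exp(tξ)`. Only smoothness at `0`, the value there and the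
velocity there matter below, so a straight line in a chart is enough. -/
theorem exists_curve_hasMFDerivAt [IsManifold (𝓡 m) ∞ G] (ξ : LieAlg m G) :
    ∃ γ : ℝ → G, γ 0 = 1 ∧ ContMDiffAt 𝓘(ℝ, ℝ) (𝓡 m) ∞ γ 0 ∧
      HasMFDerivAt 𝓘(ℝ, ℝ) (𝓡 m) γ 0 (ContinuousLinearMap.toSpanSingleton ℝ ξ) := by
  set e := chartAt (EuclideanSpace ℝ (Fin m)) (1 : G) with he
  have h1 : (1 : G) ∈ e.source := mem_chart_source _ _
  let w : EuclideanSpace ℝ (Fin m) := mfderiv (𝓡 m) (𝓡 m) e 1 ξ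
  have hmem : e 1 + (0 : ℝ) • w ∈ e.target := by simpa using e.map_source h1
  have hsmooth : ContMDiffAt (𝓡 m) (𝓡 m) ∞ e.symm (e 1 + (0 : ℝ) • w) :=
    (contMDiffOn_chart_symm (I := 𝓡 m) (n := ∞) (x := (1 : G))).contMDiffAt
      (e.open_target.mem_nhds hmem)
  have hline : ContMDiffAt 𝓘(ℝ, ℝ) (𝓡 m) ∞ (fun t : ℝ => e 1 + t • w) 0 := by
    rw [contMDiffAt_iff_contDiffAt]
    exact contDiffAt_const.add (contDiffAt_id.smul contDiffAt_const)
  refine ⟨fun t => e.symm (e 1 + t • w), by simp [e.left_inv h1], hsmooth.comp 0 hline, ?_⟩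
  have hd : HasFDerivAt (fun t : ℝ => e 1 + t • w) (ContinuousLinearMap.toSpanSingleton ℝ w) 0 :=
    (ContinuousLinearMap.toSpanSingleton ℝ w).hasFDerivAt.const_add (e 1)
  have hc := (hsmooth.mdifferentiableAt (by simp)).hasMFDerivAt.comp (0 : ℝ) hd.hasMFDerivAt
  have hw : ∀ p, p = e 1 → (mfderiv (𝓡 m) (𝓡 m) e.symm p :
      EuclideanSpace ℝ (Fin m) → EuclideanSpace ℝ (Fin m)) w = ξ := by
    rintro p rfl
    exact DFunLike.congr_fun ((mdifferentiable_chartAt (1 : G)).symm_comp_deriv h1) ξ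
  have hL : ((mfderiv (𝓡 m) (𝓡 m) e.symm (e 1 + (0 : ℝ) • w)).comp
      (ContinuousLinearMap.toSpanSingleton ℝ w) : ℝ →L[ℝ] EuclideanSpace ℝ (Fin m)) =
      ContinuousLinearMap.toSpanSingleton ℝ (ξ : EuclideanSpace ℝ (Fin m)) := by
    apply ContinuousLinearMap.ext
    intro t
    refine (ContinuousLinearMap.map_smul _ t w).trans ?_
    exact congrArg (t • ·) (hw _ (by simp))
  exact hL ▸ hc

end Curve

section PullbackToVectorSpace

variable {n : ℕ} {M : Type*} [TopologicalSpace M] [ChartedSpace (EuclideanSpace ℝ (Fin n)) M]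

/-- The pullback of a form under a map from the model space to `M`. -/
noncomputable def DiffForm.pull {k : ℕ} (α : DiffForm n M k) (ψ : EuclideanSpace ℝ (Fin n) → M)
    (y : EuclideanSpace ℝ (Fin n)) : EuclideanSpace ℝ (Fin n) [⋀^Fin k]→L[ℝ] ℝ :=
  (α (ψ y)).compContinuousLinearMap (mfderiv (𝓡 n) (𝓡 n) ψ y)

theorem DiffForm.pull_congr {k : ℕ} (α : DiffForm n M k) {ψ ψ' : EuclideanSpace ℝ (Fin n) → M}
    {y : EuclideanSpace ℝ (Fin n)} (h : ψ =ᶠ[𝓝 y] ψ') : α.pull ψ y = α.pull ψ' y := by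
  have h1 : ∀ z, z = ψ' y → (α z : EuclideanSpace ℝ (Fin n) [⋀^Fin k]→L[ℝ] ℝ) =
      (α (ψ' y) : EuclideanSpace ℝ (Fin n) [⋀^Fin k]→L[ℝ] ℝ) := by
    rintro z rfl
    rfl
  have h2 : (mfderiv (𝓡 n) (𝓡 n) ψ y : EuclideanSpace ℝ (Fin n) →L[ℝ] EuclideanSpace ℝ (Fin n)) =
      (mfderiv (𝓡 n) (𝓡 n) ψ' y : EuclideanSpace ℝ (Fin n) →L[ℝ] EuclideanSpace ℝ (Fin n)) :=
    h.mfderiv_eq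
  exact congrArg₂ (fun (a : EuclideanSpace ℝ (Fin n) [⋀^Fin k]→L[ℝ] ℝ)
    (T : EuclideanSpace ℝ (Fin n) →L[ℝ] EuclideanSpace ℝ (Fin n)) =>
      a.compContinuousLinearMap T) (h1 _ h.self_of_nhds) h2

theorem DiffForm.pull_comp {k : ℕ} (α : DiffForm n M k) {ψ : EuclideanSpace ℝ (Fin n) → M}
    {f : EuclideanSpace ℝ (Fin n) → EuclideanSpace ℝ (Fin n)} {y : EuclideanSpace ℝ (Fin n)}
    (hψ : MDifferentiableAt (𝓡 n) (𝓡 n) ψ (f y)) (hf : DifferentiableAt ℝ f y) :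
    α.pull (ψ ∘ f) y = (α.pull ψ (f y)).compContinuousLinearMap (fderiv ℝ f y) := by
  have h := mfderiv_comp y hψ hf.mdifferentiableAt
  rw [mfderiv_eq_fderiv] at h
  rw [DiffForm.pull, h]
  rfl

theorem DiffForm.pull_smul {G : Type*} [Group G] [MulAction G M] {α : DiffForm n M 2} {a : G}
    (ha : MDifferentiable (𝓡 n) (𝓡 n) (fun x : M => a • x))
    (hinv : ∀ (x : M) (u v : TangentSpace (𝓡 n) x),
      α (a • x) ![actionDeriv a x u, actionDeriv a x v] = α x ![u, v])
    {ψ : EuclideanSpace ℝ (Fin n) → M} {y : EuclideanSpace ℝ (Fin n)}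
    (hψ : MDifferentiableAt (𝓡 n) (𝓡 n) ψ y) (u v : EuclideanSpace ℝ (Fin n)) :
    α.pull ((fun x => a • x) ∘ ψ) y ![u, v] = α.pull ψ y ![u, v] := by
  have h := mfderiv_comp y (ha (ψ y)) hψ
  have h1 := hinv (ψ y) (mfderiv (𝓡 n) (𝓡 n) ψ y u) (mfderiv (𝓡 n) (𝓡 n) ψ y v)
  rw [DiffForm.pull, h]
  refine Eq.trans ?_ (h1.trans ?_)
  · refine congrArg (α (a • ψ y)) ?_
    funext i
    fin_cases i <;> rfl
  · refine congrArg (α (ψ y)) ?_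
    funext i
    fin_cases i <;> rfl

end PullbackToVectorSpace

section ChartFlow

variable {n : ℕ} {G : Type*} [Group G] {M : Type*} [TopologicalSpace M]
  [ChartedSpace (EuclideanSpace ℝ (Fin n)) M] [MulAction G M] {γ : ℝ → G} {x : M}
  {y : EuclideanSpace ℝ (Fin n)}

/-- The action of the curve `γ` in the chart of `M` at `x`. -/
noncomputable def chartFlow (γ : ℝ → G) (x : M) (p : ℝ × EuclideanSpace ℝ (Fin n)) :
    EuclideanSpace ℝ (Fin n) :=
  chartAt (EuclideanSpace ℝ (Fin n)) x
    (γ p.1 • (chartAt (EuclideanSpace ℝ (Fin n)) x).symm p.2)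

theorem chartFlow_zero (h0 : γ 0 = 1)
    (hy : y ∈ (chartAt (EuclideanSpace ℝ (Fin n)) x).target) : chartFlow γ x (0, y) = y := by
  simp [chartFlow, h0, (chartAt (EuclideanSpace ℝ (Fin n)) x).right_inv hy]

end ChartFlow

/-! ### The form `Ω(ξ_M, ·)` is smooth and closed -/

section GeneratorForm

variable {m n : ℕ} {G : Type*} [TopologicalSpace G] [ChartedSpace (EuclideanSpace ℝ (Fin m)) G]
  [Group G] {M : Type*} [TopologicalSpace M] [ChartedSpace (EuclideanSpace ℝ (Fin n)) M]
  [MulAction G M]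

/-- The contraction `Ω(ξ_M, ·)` of a 2-form with an infinitesimal generator. -/
noncomputable def generatorForm (Ω : DiffForm n M 2) (ξ : LieAlg m G) : OneForm n M := fun x =>
  let A : EuclideanSpace ℝ (Fin n) [⋀^Fin 2]→L[ℝ] ℝ := Ω x
  let u : EuclideanSpace ℝ (Fin n) := infGen (n := n) ξ x
  (altTwo (EuclideanSpace ℝ (Fin n)) A u : EuclideanSpace ℝ (Fin n) →L[ℝ] ℝ)

theorem generatorForm_apply (Ω : DiffForm n M 2) (ξ : LieAlg m G) (x : M)
    (v : TangentSpace (𝓡 n) x) : generatorForm Ω ξ x v = Ω x ![infGen ξ x, v] :=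
  altTwo_apply (E := EuclideanSpace ℝ (Fin n)) _ _ _

variable [ContMDiffSMul (𝓡 m) (𝓡 n) ∞ G M] {γ : ℝ → G} {x : M} {y : EuclideanSpace ℝ (Fin n)}
  [IsManifold (𝓡 n) ∞ M]

theorem contDiffAt_chartFlow (h0 : γ 0 = 1) (hγ : ContMDiffAt 𝓘(ℝ, ℝ) (𝓡 m) ∞ γ 0)
    (hy : y ∈ (chartAt (EuclideanSpace ℝ (Fin n)) x).target) :
    ContDiffAt ℝ ∞ (chartFlow γ x) (0, y) := by
  set e := chartAt (EuclideanSpace ℝ (Fin n)) x with he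
  have hsymm : ContMDiffAt (𝓡 n) (𝓡 n) ∞ e.symm y :=
    (contMDiffOn_chart_symm (I := 𝓡 n) (n := ∞) (x := x)).contMDiffAt (e.open_target.mem_nhds hy)
  have hγ' : ContMDiffAt 𝓘(ℝ, ℝ × EuclideanSpace ℝ (Fin n)) (𝓡 m) ∞
      (fun p : ℝ × EuclideanSpace ℝ (Fin n) => γ p.1) (0, y) :=
    ContMDiffAt.comp (g := γ) (f := Prod.fst) (0, y) hγ contDiffAt_fst.contMDiffAt
  have hs' : ContMDiffAt 𝓘(ℝ, ℝ × EuclideanSpace ℝ (Fin n)) (𝓡 n) ∞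
      (fun p : ℝ × EuclideanSpace ℝ (Fin n) => e.symm p.2) (0, y) :=
    ContMDiffAt.comp (g := e.symm) (f := Prod.snd) (0, y) hsymm contDiffAt_snd.contMDiffAt
  have hact : ContMDiffAt 𝓘(ℝ, ℝ × EuclideanSpace ℝ (Fin n)) (𝓡 n) ∞
      (fun p : ℝ × EuclideanSpace ℝ (Fin n) => γ p.1 • e.symm p.2) (0, y) :=
    ContMDiffAt.comp (0, y) (g := fun q : G × M => q.1 • q.2)
      (ContMDiffSMul.contMDiff_smul (I := 𝓡 m) (I' := 𝓡 n) (n := ∞) (G := G) (M := M) _)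
      (hγ'.prodMk hs')
  rw [← contMDiffAt_iff_contDiffAt]
  refine ContMDiffAt.comp (0, y) (g := e) (I' := 𝓡 n) ?_ hact
  refine (contMDiffOn_chart (I := 𝓡 n) (n := ∞) (x := x)).contMDiffAt (e.open_source.mem_nhds ?_)
  simpa [h0] using e.map_target hy

theorem fderiv_chartFlow (h0 : γ 0 = 1) (hγ : ContMDiffAt 𝓘(ℝ, ℝ) (𝓡 m) ∞ γ 0) {ξ : LieAlg m G}
    (hξ : HasMFDerivAt 𝓘(ℝ, ℝ) (𝓡 m) γ 0 (ContinuousLinearMap.toSpanSingleton ℝ ξ))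
    (hy : y ∈ (chartAt (EuclideanSpace ℝ (Fin n)) x).target) :
    fderiv ℝ (chartFlow γ x) (0, y) (1, 0) =
      mfderiv (𝓡 n) (𝓡 n) (chartAt (EuclideanSpace ℝ (Fin n)) x)
        ((chartAt (EuclideanSpace ℝ (Fin n)) x).symm y)
        (infGen ξ ((chartAt (EuclideanSpace ℝ (Fin n)) x).symm y)) := by
  set e := chartAt (EuclideanSpace ℝ (Fin n)) x with he
  have hsrc : e.symm y ∈ e.source := e.map_target hy
  have hsrc0 : γ 0 • e.symm y ∈ e.source := by simpa [h0] using hsrc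
  have h1 := (((mdifferentiable_chartAt x).mdifferentiableAt hsrc0).hasMFDerivAt).comp (0 : ℝ)
    (hasMFDerivAt_infGen (n := n) ξ (e.symm y) γ h0 hξ)
  have hcast : ∀ z, z = e.symm y → ∀ v : EuclideanSpace ℝ (Fin n),
      (mfderiv (𝓡 n) (𝓡 n) e z : EuclideanSpace ℝ (Fin n) → EuclideanSpace ℝ (Fin n)) v =
      (mfderiv (𝓡 n) (𝓡 n) e (e.symm y) :
        EuclideanSpace ℝ (Fin n) → EuclideanSpace ℝ (Fin n)) v := by
    rintro z rfl v
    rfl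
  let L : ℝ →L[ℝ] EuclideanSpace ℝ (Fin n) := (mfderiv (𝓡 n) (𝓡 n) e (γ 0 • e.symm y)).comp
    (ContinuousLinearMap.toSpanSingleton ℝ (infGen (n := n) ξ (e.symm y)))
  have h2 : HasFDerivAt (𝕜 := ℝ) (E := ℝ) (F := EuclideanSpace ℝ (Fin n))
      (fun t => chartFlow γ x (t, y)) L 0 := h1.hasFDerivAt
  have h3 : HasDerivAt (fun t : ℝ => (t, y)) ((1 : ℝ), (0 : EuclideanSpace ℝ (Fin n))) 0 :=
    (hasDerivAt_id (0 : ℝ)).prodMk (hasDerivAt_const (0 : ℝ) y)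
  have h5 : HasFDerivAt (chartFlow γ x) (fderiv ℝ (chartFlow γ x) (0, y)) (0, y) :=
    ((contDiffAt_chartFlow h0 hγ hy).differentiableAt (by simp)).hasFDerivAt
  have h4 : HasDerivAt (fun t => chartFlow γ x (t, y)) (fderiv ℝ (chartFlow γ x) (0, y) (1, 0)) 0 :=
    HasFDerivAt.comp_hasDerivAt (l := chartFlow γ x) (0 : ℝ) h5 h3
  refine (h4.unique h2.hasDerivAt).trans ?_
  refine Eq.trans ?_ (hcast (γ 0 • e.symm y) (by simp [h0]) _)
  exact congrArg (mfderiv (𝓡 n) (𝓡 n) e (γ 0 • e.symm y)) (one_smul ℝ _)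

/-- In the chart the generator is the time derivative of `chartFlow`; smoothness and closedness of
the contraction thus become statements about a local flow on a vector space. -/
theorem coord_generatorForm (Ω : DiffForm n M 2) (h0 : γ 0 = 1)
    (hγ : ContMDiffAt 𝓘(ℝ, ℝ) (𝓡 m) ∞ γ 0) {ξ : LieAlg m G}
    (hξ : HasMFDerivAt 𝓘(ℝ, ℝ) (𝓡 m) γ 0 (ContinuousLinearMap.toSpanSingleton ℝ ξ))
    (hy : y ∈ (chartAt (EuclideanSpace ℝ (Fin n)) x).target) :
    (generatorForm Ω ξ).coord (chartAt (EuclideanSpace ℝ (Fin n)) x) y =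
      altTwo _ (Ω.inChart (chartAt (EuclideanSpace ℝ (Fin n)) x) y)
        (fderiv ℝ (chartFlow γ x) (0, y) (1, 0)) := by
  set e := chartAt (EuclideanSpace ℝ (Fin n)) x with he
  have h1 := DFunLike.congr_fun ((mdifferentiable_chartAt x).comp_symm_deriv hy)
  have hgen : mfderiv (𝓡 n) (𝓡 n) e.symm y (fderiv ℝ (chartFlow γ x) (0, y) (1, 0)) =
      infGen ξ (e.symm y) := by
    have hinj := (mdifferentiable_chartAt x).mfderiv_injective (e.map_target hy)
    apply hinj
    rw [← fderiv_chartFlow h0 hγ hξ hy]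
    exact h1 _
  ext v
  rw [altTwo_apply]
  refine (generatorForm_apply Ω ξ (e.symm y) _).trans ?_
  rw [← hgen]
  refine congrArg (Ω (e.symm y)) ?_
  funext i
  fin_cases i <;> rfl

theorem generatorForm_isSmooth [IsManifold (𝓡 m) ∞ G] {Ω : DiffForm n M 2} (hΩ : Ω.IsSmooth)
    (ξ : LieAlg m G) : (generatorForm Ω ξ).IsSmooth := by
  obtain ⟨γ, h0, hγ, hξ⟩ := exists_curve_hasMFDerivAt ξ
  rw [OneForm.isSmooth_iff]
  intro x
  refine ContDiffOn.congr ?_ fun y hy => coord_generatorForm Ω h0 hγ hξ hy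
  intro y hy
  exact ((contDiff_altTwo.contDiffAt.comp_contDiffWithinAt y (hΩ x y hy)).clm_apply
    (contDiffAt_flow_generator (contDiffAt_chartFlow h0 hγ hy)).contDiffWithinAt)

theorem inChart_chartFlow {Ω : DiffForm n M 2}
    (hinv : ∀ (a : G) (x : M) (u v : TangentSpace (𝓡 n) x),
      Ω (a • x) ![actionDeriv a x u, actionDeriv a x v] = Ω x ![u, v])
    (h0 : γ 0 = 1) (hγ : ContMDiffAt 𝓘(ℝ, ℝ) (𝓡 m) ∞ γ 0)
    (hy : y ∈ (chartAt (EuclideanSpace ℝ (Fin n)) x).target) :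
    ∀ᶠ t in 𝓝 (0 : ℝ), ∀ u v, Ω.inChart (chartAt (EuclideanSpace ℝ (Fin n)) x)
      (chartFlow γ x (t, y)) ![fderiv ℝ (chartFlow γ x) (t, y) (0, u),
        fderiv ℝ (chartFlow γ x) (t, y) (0, v)] =
      Ω.inChart (chartAt (EuclideanSpace ℝ (Fin n)) x) y ![u, v] := by
  set e := chartAt (EuclideanSpace ℝ (Fin n)) x with he
  have hd1 : ∀ᶠ p in 𝓝 ((0 : ℝ), y), ContDiffAt ℝ 1 (chartFlow γ x) p :=
    ((contDiffAt_chartFlow h0 hγ hy).of_le (by simp)).eventually (by simp)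
  have hcurve : ContinuousAt (fun t : ℝ => (t, y)) 0 := by fun_prop
  have hsrc : ∀ᶠ t in 𝓝 (0 : ℝ), γ t • e.symm y ∈ e.source := by
    have hc : ContinuousAt (fun t => γ t • e.symm y) 0 :=
      (contMDiff_smul_const m n (e.symm y)).continuous.continuousAt.comp hγ.continuousAt
    refine hc.eventually (e.open_source.mem_nhds ?_)
    simpa [h0] using e.map_target hy
  filter_upwards [hcurve.eventually hd1, hsrc] with t ht hts u v
  have hdt : HasFDerivAt (fun z => chartFlow γ x (t, z)) ((fderiv ℝ (chartFlow γ x) (t, y)).comp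
      (ContinuousLinearMap.inr ℝ ℝ (EuclideanSpace ℝ (Fin n)))) y :=
    HasFDerivAt.comp y (ht.differentiableAt (by simp)).hasFDerivAt (hasFDerivAt_prodMk_right t y)
  have hsd : MDifferentiableAt (𝓡 n) (𝓡 n) e.symm y :=
    (mdifferentiable_chartAt x).mdifferentiableAt_symm hy
  have hcs := contMDiff_const_smul' m n (M := M) (γ t)
  -- Near `y`, `chartFlow` at time `t` is the action of `γ t` conjugated by the chart, so invariance
  -- of `Ω` passes to its coordinate expression.
  have hev : e.symm ∘ (fun z => chartFlow γ x (t, z)) =ᶠ[𝓝 y]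
      (fun x => γ t • x) ∘ e.symm := by
    have hc : ContinuousAt (fun z => γ t • e.symm z) y :=
      hcs.continuous.continuousAt.comp (e.symm.continuousAt hy)
    filter_upwards [hc.eventually (e.open_source.mem_nhds hts)] with z hz
    exact e.left_inv hz
  have hp1 := DiffForm.pull_comp Ω (ψ := e.symm) (f := fun z => chartFlow γ x (t, z)) (y := y)
    ((mdifferentiable_chartAt x).mdifferentiableAt_symm (e.map_source hts)) hdt.differentiableAt
  rw [DiffForm.pull_congr Ω hev] at hp1
  have hp2 := DiffForm.pull_smul (hcs.mdifferentiable (by simp)) (hinv (γ t)) hsd u v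
  rw [hp1, hdt.fderiv] at hp2
  refine Eq.trans ?_ hp2
  refine congrArg (Ω.inChart e (chartFlow γ x (t, y))) ?_
  funext i
  fin_cases i <;> rfl

theorem generatorForm_isClosed [IsManifold (𝓡 m) ∞ G] {Ω : DiffForm n M 2} (hΩ : Ω.IsSmooth)
    (hclosed : Ω.IsClosed)
    (hinv : ∀ (a : G) (x : M) (u v : TangentSpace (𝓡 n) x),
      Ω (a • x) ![actionDeriv a x u, actionDeriv a x v] = Ω x ![u, v])
    (ξ : LieAlg m G) : (generatorForm Ω ξ).IsClosed := by
  obtain ⟨γ, h0, hγ, hξ⟩ := exists_curve_hasMFDerivAt ξ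
  rw [(generatorForm_isSmooth hΩ ξ).isClosed_iff]
  intro x y hy u v
  set e := chartAt (EuclideanSpace ℝ (Fin n)) x with he
  have hev : (generatorForm Ω ξ).coord e =ᶠ[𝓝 y] fun z => altTwo _ (Ω.inChart e z)
      (fderiv ℝ (chartFlow γ x) (0, z) (1, 0)) := by
    filter_upwards [e.open_target.mem_nhds hy] with z hz
    exact coord_generatorForm Ω h0 hγ hξ hz
  have hΩd : DifferentiableAt ℝ (Ω.inChart e) y :=
    ((hΩ x).contDiffAt (e.open_target.mem_nhds hy)).differentiableAt (by simp)
  rw [hev.fderiv_eq]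
  refine fderiv_contraction_symm (b := fun z => altTwo _ (Ω.inChart e z))
    (contDiffAt_chartFlow h0 hγ hy) ?_
    (((contDiff_altTwo.differentiable (by simp) _).comp y hΩd).hasFDerivAt) (altTwo_swap _) ?_ ?_ u v
  · filter_upwards [e.open_target.mem_nhds hy] with z hz using chartFlow_zero h0 hz
  · intro p q r
    refine (extDeriv_two_apply hΩd p q r).symm.trans ?_
    rw [hclosed x y hy]
    rfl
  · filter_upwards [inChart_chartFlow hinv h0 hγ hy] with t ht u v
    rw [altTwo_apply, altTwo_apply]
    exact ht u v

end GeneratorForm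

/-! ### Compatible triples and the dual of the generator form -/

section Compatible

variable {E : Type*} [NormedAddCommGroup E] [NormedSpace ℝ E]

theorem altTwo_neg_right (f : E [⋀^Fin 2]→L[ℝ] ℝ) (u v : E) : f ![u, -v] = -f ![u, v] := by
  rw [← altTwo_apply, ← altTwo_apply, map_neg]

theorem alternating_two_swap (f : E [⋀^Fin 2]→L[ℝ] ℝ) (u v : E) : f ![u, v] = -f ![v, u] := by
  rw [← altTwo_apply, ← altTwo_apply, altTwo_swap]

variable {m n : ℕ} {M : Type*} [TopologicalSpace M] [ChartedSpace (EuclideanSpace ℝ (Fin n)) M]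
  [IsManifold (𝓡 n) ∞ M] {Ω : DiffForm n M 2} {g : Metric n M} {J : EndField n M}

theorem IsCompatibleTriple.apply_J_right (h : IsCompatibleTriple Ω g J) (x : M)
    (u v : TangentSpace (𝓡 n) x) : g.inner x u (J x v) = -Ω x ![u, v] := by
  rw [h.compatible, h.almostComplex.sq]
  exact altTwo_neg_right (E := EuclideanSpace ℝ (Fin n)) (Ω x) u v

theorem IsCompatibleTriple.apply_J_left (h : IsCompatibleTriple Ω g J) (x : M)
    (u v : TangentSpace (𝓡 n) x) : g.inner x (J x u) v = Ω x ![u, v] := by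
  rw [g.symm, h.apply_J_right]
  exact (alternating_two_swap (E := EuclideanSpace ℝ (Fin n)) (Ω x) u v).symm

theorem IsCompatibleTriple.inner_J (h : IsCompatibleTriple Ω g J) (x : M)
    (u v : TangentSpace (𝓡 n) x) : g.inner x (J x u) (J x v) = g.inner x u v := by
  rw [h.apply_J_left, h.compatible]

variable {G : Type*} [TopologicalSpace G] [ChartedSpace (EuclideanSpace ℝ (Fin m)) G]
  [Group G] [MulAction G M]

theorem IsCompatibleTriple.sharp_generatorForm (h : IsCompatibleTriple Ω g J) (ξ : LieAlg m G)
    (x : M) : sharp g x (generatorForm Ω ξ x) = J x (infGen ξ x) :=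
  sharp_eq_of_forall g fun w => by rw [h.apply_J_left, generatorForm_apply]

theorem IsCompatibleTriple.generatorForm_memL2 [MeasurableSpace M] {lam : Measure M}
    (h : IsCompatibleTriple Ω g J) {ξ : LieAlg m G}
    (hgen : vectorFieldMemL2 g lam (fun x => infGen ξ x)) : (generatorForm Ω ξ).MemL2 g lam := by
  have h1 : (fun x => Real.sqrt (formInner g (generatorForm Ω ξ) (generatorForm Ω ξ) x)) =
      fun x => Real.sqrt (g.inner x (infGen ξ x) (infGen ξ x)) := by
    funext x
    rw [formInner, h.sharp_generatorForm, h.inner_J]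
  rw [OneForm.MemL2, h1]
  exact hgen

/-- The vector dual to the generator form is `J ξ_M`, and moving `J` to the other factor leaves `Jχ`
evaluated on `ξ_M`. This links the metric to the vanishing of harmonic forms on generators. -/
theorem IsCompatibleTriple.formInner_generatorForm (h : IsCompatibleTriple Ω g J)
    (ξ : LieAlg m G) (χ : OneForm n M) (x : M) :
    formInner g (generatorForm Ω ξ) χ x = χ.applyJ J x (infGen ξ x) := by
  rw [formInner_comm, formInner_eq_apply_sharp, h.sharp_generatorForm]
  rfl

end Compatible

/-! ### Harmonic forms that vanish almost everywhere -/

section Support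

variable {n : ℕ} {M : Type*} [TopologicalSpace M] [ChartedSpace (EuclideanSpace ℝ (Fin n)) M]
  [IsManifold (𝓡 n) ∞ M]

theorem OneForm.coord_ne_zero {χ : OneForm n M} {x : M} (hx : χ x ≠ 0) :
    χ.coord (chartAt (EuclideanSpace ℝ (Fin n)) x) (chartAt (EuclideanSpace ℝ (Fin n)) x x) ≠ 0 := by
  intro h
  refine hx (OneForm.eq_of_coord_eq (β := 0) x (mem_chart_source _ x) ?_)
  rw [h]
  exact (ContinuousLinearMap.zero_comp _).symm

theorem OneForm.LocallyExact.eventually_ne_zero {χ : OneForm n M} (hχ : χ.LocallyExact) {x : M}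
    (hx : χ x ≠ 0) : ∀ᶠ y in 𝓝 x, χ y ≠ 0 := by
  set e := chartAt (EuclideanSpace ℝ (Fin n)) x with he
  have hxs : x ∈ e.source := mem_chart_source _ x
  have hcont : ContinuousAt (χ.coord e) (e x) :=
    ((χ.isSmooth_iff.1 hχ.isSmooth x).continuousOn.continuousAt
      (e.open_target.mem_nhds (e.map_source hxs)))
  have h1 : ∀ᶠ z in 𝓝 (e x), χ (e.symm z) ≠ 0 := by
    filter_upwards [hcont.eventually_ne (OneForm.coord_ne_zero hx)] with z hz h0
    apply hz
    rw [OneForm.coord, h0]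
    exact ContinuousLinearMap.zero_comp _
  filter_upwards [(e.continuousAt hxs).eventually h1, e.open_source.mem_nhds hxs] with y hy hys
  rwa [e.left_inv hys] at hy

/-- Take a bump function supported in `U` times the linear coordinate function whose differential at
`x` is `χ x`. -/
theorem exists_dFun_ne_zero [T2Space M] {χ : OneForm n M} {x : M} (hx : χ x ≠ 0) {U : Set M}
    (hU : U ∈ 𝓝 x) : ∃ φ : M → ℝ, ContMDiff (𝓡 n) 𝓘(ℝ, ℝ) ∞ φ ∧
      (dFun φ : OneForm n M) x ≠ 0 ∧ ∀ y ∉ U, (dFun φ : OneForm n M) y = 0 := by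
  set e := chartAt (EuclideanSpace ℝ (Fin n)) x with he
  have hxs : x ∈ e.source := mem_chart_source _ x
  obtain ⟨ρ, -, hρ⟩ := (SmoothBumpFunction.nhds_basis_tsupport (I := 𝓡 n) x).mem_iff.1 hU
  set ℓ : EuclideanSpace ℝ (Fin n) →L[ℝ] ℝ := χ.coord e (e x) with hℓ
  have hℓ0 : ℓ ≠ 0 := OneForm.coord_ne_zero hx
  have hφ : ContMDiff (𝓡 n) 𝓘(ℝ, ℝ) ∞ (fun y => ρ y • ℓ (e y)) := by
    refine ρ.contMDiff_smul ?_
    exact ℓ.contDiff.contMDiff.comp_contMDiffOn (contMDiffOn_chart (I := 𝓡 n) (n := ∞) (x := x))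
  refine ⟨fun y => ρ y • ℓ (e y), hφ, ?_, ?_⟩
  · intro h0
    have hsymm : Tendsto e.symm (𝓝 (e x)) (𝓝 x) := by
      have := e.symm.continuousAt (e.map_source hxs)
      rwa [ContinuousAt, e.left_inv hxs] at this
    have hev : (fun y => ρ y • ℓ (e y)) ∘ e.symm =ᶠ[𝓝 (e x)] ℓ := by
      filter_upwards [hsymm.eventually ρ.eventuallyEq_one,
        e.open_target.mem_nhds (e.map_source hxs)] with z hz hzt
      simp [hz, e.right_inv hzt]
    have h1 := OneForm.coord_dFun x (e.map_source hxs) (F := fun y => ρ y • ℓ (e y))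
      (hφ.mdifferentiable (by simp) _)
    rw [hev.fderiv_eq, ContinuousLinearMap.fderiv] at h1
    have h2 : ∀ z, z = x → (dFun (fun y => ρ y • ℓ (e y)) : OneForm n M) z = 0 := by
      rintro z rfl
      exact h0
    apply hℓ0
    rw [← h1, OneForm.coord, h2 _ (e.left_inv hxs)]
    exact ContinuousLinearMap.zero_comp _
  · intro y hy
    have hyt : y ∉ tsupport ρ := fun h => hy (hρ h)
    have hev : (fun y => ρ y • ℓ (e y)) =ᶠ[𝓝 y] fun _ => (0 : ℝ) := by
      filter_upwards [(isClosed_tsupport ρ).isOpen_compl.mem_nhds hyt] with z hz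
      simp [image_eq_zero_of_notMem_tsupport hz]
    have h1 : (dFun (fun y => ρ y • ℓ (e y)) : OneForm n M) y =
        (dFun (fun _ => (0 : ℝ)) : OneForm n M) y := hev.mfderiv_eq
    rw [h1]
    exact mvfderiv_const (0 : ℝ)

end Support

section Harmonic

variable {n : ℕ} {M : Type*} [TopologicalSpace M] [ChartedSpace (EuclideanSpace ℝ (Fin n)) M]
  [IsManifold (𝓡 n) ∞ M] [MeasurableSpace M] {g : Metric n M} {lam : Measure M}

theorem OneForm.LocallyExact.isL2Harmonic_of_ae_eq_zero {α : OneForm n M} (hα : α.LocallyExact)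
    (h0 : ∀ᵐ x ∂lam, α x = 0) : IsL2Harmonic g lam α := by
  refine ⟨hα.isSmooth, hα.isClosed, fun φ _ _ => ?_, ?_⟩
  · rw [integral_eq_zero_of_ae, integral_eq_zero_of_ae]
    · exact Eventually.of_forall fun x => zero_mul _
    · filter_upwards [h0] with x hx
      rw [formInner_eq_apply_sharp, hx]
      rfl
  · refine (memLp_congr_ae (f := fun _ : M => (0 : ℝ)) ?_).1 MemLp.zero
    filter_upwards [h0] with x hx
    rw [(formInner_self_eq_zero_iff g α x).2 hx, Real.sqrt_zero]

/-- Uniqueness of harmonic representatives implies that a harmonic form vanishes if it vanishes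
almost everywhere, although the measure need not have full support a priori. -/
theorem IsL2Harmonic.eq_zero_of_ae [T2Space M] (hrep : HasUniqueHarmonicRepresentatives g lam)
    {χ : OneForm n M} (hχ : IsL2Harmonic g lam χ) (h0 : ∀ᵐ x ∂lam, χ x = 0) : χ = 0 := by
  by_contra hne
  -- The set where `χ` is nonzero is open and null. A differential `dφ` supported there vanishes
  -- almost everywhere, so it is harmonic; being exact, it must equal the harmonic form `0`,
  -- contrary to `dφ ≠ 0` at `x`.
  obtain ⟨x, hx⟩ := Function.ne_iff.1 hne
  obtain ⟨φ, hφ, hφx, hφU⟩ := exists_dFun_ne_zero hx (hχ.locallyExact.eventually_ne_zero hx)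
  have h1 : IsL2Harmonic g lam (dFun φ) := by
    refine (dFun_locallyExact hφ).isL2Harmonic_of_ae_eq_zero ?_
    filter_upwards [h0] with y hy
    exact hφU y fun h => h hy
  have h2 : IsL2Harmonic g lam (0 : OneForm n M) :=
    OneForm.LocallyExact.isL2Harmonic_of_ae_eq_zero
      (fun _ => ⟨_, OneForm.IsPrimitiveNear.zero⟩) (Eventually.of_forall fun _ => rfl)
  exact hφx (congrFun (hrep.eq h1 h2 hφ (sub_zero _)) x)

end Harmonic

/-! ### The generator form is exact -/

section GeneratorExact

variable {m n : ℕ} {G : Type*} [TopologicalSpace G] [ChartedSpace (EuclideanSpace ℝ (Fin m)) G]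
  [Group G] [LieGroup (𝓡 m) ∞ G] [ConnectedSpace G]
  {M : Type*} [TopologicalSpace M] [ChartedSpace (EuclideanSpace ℝ (Fin n)) M]
  [IsManifold (𝓡 n) ∞ M] [MeasurableSpace M] [BorelSpace M] [MulAction G M]
  [ContMDiffSMul (𝓡 m) (𝓡 n) ∞ G M] {Ω : DiffForm n M 2} {g : Metric n M} {J : EndField n M}
  {lam : Measure M}

/-- Harmonic forms vanish on the infinitesimal generators. -/
theorem IsL2Harmonic.apply_infGen (hinv : IsInvariantTriple G Ω g J)
    (hlam : ∀ a : G, MeasurePreserving (fun x : M => a • x) lam lam)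
    (hrep : HasUniqueHarmonicRepresentatives g lam)
    (hfix : ∀ x : M, ∃ y ∈ connectedComponent x, ∀ a : G, a • y = y)
    {χ : OneForm n M} (hχ : IsL2Harmonic g lam χ) (ξ : LieAlg m G) (x : M) :
    χ x (infGen ξ x) = 0 := by
  refine hχ.locallyExact.apply_infGen_eq_zero (fun a : G => ?_) hfix ξ x
  obtain ⟨F, hF, hd⟩ := hχ.locallyExact.exists_pullback_smul_sub m a
  exact hrep.eq (hχ.pullback_smul m (hinv.metric a) (hlam a)) hχ hF hd

theorem generatorForm_exact [T2Space M] (hcomp : IsCompatibleTriple Ω g J)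
    (hinv : IsInvariantTriple G Ω g J)
    (hlam : ∀ a : G, MeasurePreserving (fun x : M => a • x) lam lam)
    (hHodge : HasHodgeDecomposition g lam) (hrep : HasUniqueHarmonicRepresentatives g lam)
    (hJ : ∀ α : OneForm n M, IsL2Harmonic g lam α → IsL2Harmonic g lam (OneForm.applyJ J α))
    (hfix : ∀ x : M, ∃ y ∈ connectedComponent x, ∀ a : G, a • y = y) {ξ : LieAlg m G}
    (hgen : vectorFieldMemL2 g lam (fun x => infGen ξ x)) :
    ∃ h : M → ℝ, ContMDiff (𝓡 n) 𝓘(ℝ, ℝ) ∞ h ∧ generatorForm Ω ξ = dFun h := by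
  have hs := hcomp.symplectic.smooth
  obtain ⟨h, χ, hh, -, -, hχ, hdec, horth⟩ := hHodge (generatorForm Ω ξ)
    (generatorForm_isSmooth hs ξ)
    (generatorForm_isClosed hs hcomp.symplectic.closed hinv.form ξ)
    (hcomp.generatorForm_memL2 hgen)
  -- Pointwise, not only after integration: `⟨⟨dh + χ, χ⟩⟩ = (Jχ)(ξ_M) = 0`.
  have hpt : ∀ x, formInner g χ χ x = -formInner g (dFun h) χ x := by
    intro x
    have h1 : formInner g (generatorForm Ω ξ) χ x = 0 := by
      rw [hcomp.formInner_generatorForm]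
      exact (hJ χ hχ).apply_infGen hinv hlam hrep hfix ξ x
    rw [hdec, formInner_eq_apply_sharp, Pi.add_apply] at h1
    rw [formInner_eq_apply_sharp, formInner_eq_apply_sharp]
    exact eq_neg_of_add_eq_zero_right h1
  have hint : ∫ x, formInner g χ χ x ∂lam = 0 := by
    simp_rw [hpt]
    rw [integral_neg, horth, neg_zero]
  -- Without integrability the integral would be `0` by convention and would carry no information.
  have hintegrable : Integrable (formInner g χ χ) lam := by
    refine hχ.memL2.integrable_sq.congr (Eventually.of_forall fun x => ?_)
    exact Real.sq_sqrt (formInner_self_nonneg g χ x)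
  have hae := (integral_eq_zero_iff_of_nonneg (fun x => formInner_self_nonneg g χ x)
    hintegrable).1 hint
  have hχ0 : χ = 0 := by
    refine hχ.eq_zero_of_ae hrep ?_
    filter_upwards [hae] with x hx
    exact (formInner_self_eq_zero_iff g χ x).1 hx
  exact ⟨h, hh, by rw [hdec, hχ0, add_zero]⟩

end GeneratorExact

/-! ### Primitives normalized at base points -/

section BasePoint

theorem exists_component_basepoint {M : Type*} [TopologicalSpace M] {p : M → Prop}
    (h : ∀ x : M, ∃ y ∈ connectedComponent x, p y) :
    ∃ c : M → M, (∀ x, c x ∈ connectedComponent x) ∧ (∀ x, p (c x)) ∧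
      ∀ x, ∀ y ∈ connectedComponent x, c y = c x := by
  choose f hf hp using h
  -- Choosing first a representative of the component makes the base point depend on the component
  -- only.
  refine ⟨fun x => f (Quotient.out (x : ConnectedComponents M)), fun x => ?_, fun x => hp _,
    fun x y hy => ?_⟩
  · have h1 : ((Quotient.out (x : ConnectedComponents M) : M) : ConnectedComponents M) = x :=
      Quotient.out_eq _
    rw [ConnectedComponents.coe_eq_coe] at h1
    exact h1 ▸ hf _
  · simp only
    rw [ConnectedComponents.coe_eq_coe'.2 hy]

variable {n : ℕ} {M : Type*} [TopologicalSpace M] [ChartedSpace (EuclideanSpace ℝ (Fin n)) M]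

/-- Subtract `h ∘ c`, which is locally constant because components are open and `c` is constant on
each. -/
theorem exists_normalized_primitive {α : OneForm n M} {h : M → ℝ}
    (hh : ContMDiff (𝓡 n) 𝓘(ℝ, ℝ) ∞ h) (hα : α = dFun h) {c : M → M}
    (hc : ∀ x, c x ∈ connectedComponent x) (hcc : ∀ x, ∀ y ∈ connectedComponent x, c y = c x) :
    ∃ k : M → ℝ, ContMDiff (𝓡 n) 𝓘(ℝ, ℝ) ∞ k ∧ α = dFun k ∧ ∀ x, k (c x) = 0 := by
  have : LocallyConnectedSpace M :=
    ChartedSpace.locallyConnectedSpace (EuclideanSpace ℝ (Fin n)) M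
  have key : ∀ x, α.IsPrimitiveNear (fun y => h y - h (c y)) x := by
    intro x
    have h1 : α.IsPrimitiveNear h x := Eventually.of_forall fun y => ⟨hh y, by rw [hα]⟩
    have h2 : (0 : OneForm n M).IsPrimitiveNear (fun _ => h (c x)) x :=
      Eventually.of_forall fun _ => ⟨contMDiffAt_const, (mvfderiv_const (h (c x))).symm⟩
    have h3 := h1.sub h2
    rw [sub_zero] at h3
    refine h3.congr ?_
    filter_upwards [isOpen_connectedComponent.mem_nhds (mem_connectedComponent (x := x))] with y hy
    simp [hcc x y hy]
  exact ⟨_, fun x => (key x).self_of_nhds.1, funext fun x => (key x).self_of_nhds.2,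
    fun x => by simp [hcc x (c x) (hc x)]⟩

theorem eq_zero_of_dFun_eq_zero_of_basepoint [IsManifold (𝓡 n) ∞ M] {c : M → M}
    (hc : ∀ x, c x ∈ connectedComponent x) {F : M → ℝ} (hF : ContMDiff (𝓡 n) 𝓘(ℝ, ℝ) ∞ F)
    (hd : (dFun F : OneForm n M) = 0) (h0 : ∀ x, F (c x) = 0) (x : M) : F x = 0 :=
  (eq_of_dFun_eq_zero (hF.mdifferentiable (by simp)) hd (hc x)).symm.trans (h0 x)

theorem dFun_add {F F' : M → ℝ} (hF : ContMDiff (𝓡 n) 𝓘(ℝ, ℝ) ∞ F)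
    (hF' : ContMDiff (𝓡 n) 𝓘(ℝ, ℝ) ∞ F') :
    (dFun (F + F') : OneForm n M) = dFun F + dFun F' :=
  funext fun x => mvfderiv_add (hF.mdifferentiable (by simp) x) (hF'.mdifferentiable (by simp) x)

theorem dFun_sub {F F' : M → ℝ} (hF : ContMDiff (𝓡 n) 𝓘(ℝ, ℝ) ∞ F)
    (hF' : ContMDiff (𝓡 n) 𝓘(ℝ, ℝ) ∞ F') :
    (dFun (F - F') : OneForm n M) = dFun F - dFun F' :=
  funext fun x => mvfderiv_sub (hF.mdifferentiable (by simp) x) (hF'.mdifferentiable (by simp) x)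

theorem dFun_const_smul {F : M → ℝ} (r : ℝ) (hF : ContMDiff (𝓡 n) 𝓘(ℝ, ℝ) ∞ F) :
    (dFun (r • F) : OneForm n M) = r • dFun F := by
  funext x
  have h : r • F = (fun _ : M => r) • F := rfl
  refine (congrArg (fun f => (dFun f : OneForm n M) x) h).trans ?_
  refine (mvfderiv_smul (a := fun _ : M => r) mdifferentiableAt_const
    (hF.mdifferentiable (by simp) x)).trans ?_
  rw [mvfderiv_const]
  ext v
  simp [dFun]

end BasePoint

/-! ### Assembling the momentum map -/

section MomentMap

variable {m n : ℕ} {G : Type*} [TopologicalSpace G] [ChartedSpace (EuclideanSpace ℝ (Fin m)) G]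
  [Group G] {M : Type*} [TopologicalSpace M] [ChartedSpace (EuclideanSpace ℝ (Fin n)) M]
  [MulAction G M]

theorem generatorForm_add (Ω : DiffForm n M 2) (ξ η : LieAlg m G) :
    generatorForm Ω (ξ + η) = generatorForm Ω ξ + generatorForm Ω η := by
  funext x
  have h : infGen (n := n) (ξ + η) x = infGen ξ x + infGen η x := map_add _ ξ η
  simp only [generatorForm, h, Pi.add_apply]
  exact map_add (altTwo (EuclideanSpace ℝ (Fin n)) (Ω x)) _ _

theorem generatorForm_smul (Ω : DiffForm n M 2) (r : ℝ) (ξ : LieAlg m G) :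
    generatorForm Ω (r • ξ) = r • generatorForm Ω ξ := by
  funext x
  have h : infGen (n := n) (r • ξ) x = r • infGen ξ x := map_smul _ r ξ
  simp only [generatorForm, h, Pi.smul_apply]
  exact map_smul (altTwo (EuclideanSpace ℝ (Fin n)) (Ω x)) r _

variable [ContMDiffSMul (𝓡 m) (𝓡 n) ∞ G M]

/-- Differentiate `(a b a⁻¹) • (a • x) = a • (b • x)` in `b` at `1`. -/
theorem infGen_Ad [LieGroup (𝓡 m) ∞ G] (a : G) (ξ : LieAlg m G) (x : M) :
    infGen (n := n) (Ad a ξ) (a • x) = actionDeriv a x (infGen ξ x) := by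
  have hconj : ContMDiff (𝓡 m) (𝓡 m) ∞ (fun b : G => a * b * a⁻¹) :=
    (contMDiff_mul_right (I := 𝓡 m) (n := ∞) (a := a⁻¹)).comp
      (contMDiff_mul_left (I := 𝓡 m) (n := ∞) (a := a))
  have horb := fun y : M => (contMDiff_smul_const (G := G) m n y).mdifferentiable (by simp)
  have hact := (contMDiff_const_smul' m n (M := M) a).mdifferentiable (by simp)
  have h1 := mfderiv_comp (1 : G) (horb (a • x) (a * 1 * a⁻¹)) (hconj.mdifferentiable (by simp) 1)
  have h2 := mfderiv_comp (1 : G) (hact ((1 : G) • x)) (horb x 1)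
  have hf : (fun c : G => c • a • x) ∘ (fun b : G => a * b * a⁻¹) =
      (fun y : M => a • y) ∘ fun b : G => b • x := by
    funext b
    simp [mul_smul]
  have hcast1 : ∀ c : G, c = 1 → ∀ v : EuclideanSpace ℝ (Fin m),
      (mfderiv (𝓡 m) (𝓡 n) (fun c : G => c • a • x) c :
        EuclideanSpace ℝ (Fin m) → EuclideanSpace ℝ (Fin n)) v =
      (mfderiv (𝓡 m) (𝓡 n) (fun c : G => c • a • x) 1 :
        EuclideanSpace ℝ (Fin m) → EuclideanSpace ℝ (Fin n)) v := by
    rintro c rfl v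
    rfl
  have hcast2 : ∀ z : M, z = x → ∀ v : EuclideanSpace ℝ (Fin n),
      (mfderiv (𝓡 n) (𝓡 n) (fun y : M => a • y) z :
        EuclideanSpace ℝ (Fin n) → EuclideanSpace ℝ (Fin n)) v =
      (mfderiv (𝓡 n) (𝓡 n) (fun y : M => a • y) x :
        EuclideanSpace ℝ (Fin n) → EuclideanSpace ℝ (Fin n)) v := by
    rintro z rfl v
    rfl
  have hcast3 : ∀ f f' : G → M, f = f' →
      (mfderiv (𝓡 m) (𝓡 n) f 1 : EuclideanSpace ℝ (Fin m) → EuclideanSpace ℝ (Fin n)) ξ =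
      (mfderiv (𝓡 m) (𝓡 n) f' 1 : EuclideanSpace ℝ (Fin m) → EuclideanSpace ℝ (Fin n)) ξ := by
    rintro f f' rfl
    rfl
  refine (hcast1 (a * 1 * a⁻¹) (by simp) _).symm.trans ?_
  refine (DFunLike.congr_fun h1 ξ).symm.trans ?_
  refine (hcast3 _ _ hf).trans ?_
  refine (DFunLike.congr_fun h2 ξ).trans ?_
  exact hcast2 _ (one_smul G x) _

theorem pullback_generatorForm_Ad [LieGroup (𝓡 m) ∞ G] {Ω : DiffForm n M 2}
    (hinv : ∀ (a : G) (x : M) (u v : TangentSpace (𝓡 n) x),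
      Ω (a • x) ![actionDeriv a x u, actionDeriv a x v] = Ω x ![u, v])
    (a : G) (ξ : LieAlg m G) :
    (generatorForm Ω (Ad a ξ)).pullback (fun x => a • x) = generatorForm Ω ξ := by
  funext y
  ext v
  refine (generatorForm_apply Ω (Ad a ξ) (a • y) _).trans ?_
  rw [infGen_Ad]
  exact (hinv a y (infGen ξ y) v).trans (generatorForm_apply Ω ξ y v).symm

variable [IsManifold (𝓡 n) ∞ M]

/-- A primitive that vanishes at all base points is unique. Additivity, homogeneity and equivariance
each compare two primitives of one form; for equivariance, the translated primitive is still
normalized because base points are fixed by `G`. -/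
theorem isHamiltonian_of_exact [LieGroup (𝓡 m) ∞ G] {Ω : DiffForm n M 2}
    (hinv : ∀ (a : G) (x : M) (u v : TangentSpace (𝓡 n) x),
      Ω (a • x) ![actionDeriv a x u, actionDeriv a x v] = Ω x ![u, v])
    (hfix : ∀ x : M, ∃ y ∈ connectedComponent x, ∀ a : G, a • y = y)
    (hex : ∀ ξ : LieAlg m G, ∃ h : M → ℝ, ContMDiff (𝓡 n) 𝓘(ℝ, ℝ) ∞ h ∧
      generatorForm Ω ξ = dFun h) : IsHamiltonian m G Ω := by
  obtain ⟨c, hc, hcfix, hcc⟩ := exists_component_basepoint hfix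
  have hk : ∀ ξ : EuclideanSpace ℝ (Fin m), ∃ k : M → ℝ, ContMDiff (𝓡 n) 𝓘(ℝ, ℝ) ∞ k ∧
      generatorForm (G := G) Ω ξ = dFun k ∧ ∀ x, k (c x) = 0 := by
    intro ξ
    obtain ⟨h, hh, hd⟩ := hex ξ
    exact exists_normalized_primitive hh hd hc hcc
  choose k hks hkd hk0 using hk
  have hadd : ∀ ξ η, k (ξ + η) = k ξ + k η := by
    intro ξ η
    have hs := (hks ξ).add (hks η)
    funext x
    refine sub_eq_zero.1 (eq_zero_of_dFun_eq_zero_of_basepoint (n := n) hc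
      (F := k (ξ + η) - (k ξ + k η)) ((hks (ξ + η)).sub hs) ?_ (fun x => by simp [hk0]) x)
    rw [dFun_sub (hks _) hs, dFun_add (hks ξ) (hks η), ← hkd, ← hkd, ← hkd]
    exact sub_eq_zero.2 (generatorForm_add Ω (ξ : LieAlg m G) η)
  have hsmul : ∀ (r : ℝ) ξ, k (r • ξ) = r • k ξ := by
    intro r ξ
    have hs : ContMDiff (𝓡 n) 𝓘(ℝ, ℝ) ∞ (r • k ξ) :=
      (contDiff_const.mul contDiff_id : ContDiff ℝ ∞ fun t : ℝ => r * t).contMDiff.comp (hks ξ)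
    funext x
    refine sub_eq_zero.1 (eq_zero_of_dFun_eq_zero_of_basepoint (n := n) hc
      (F := k (r • ξ) - r • k ξ) ((hks (r • ξ)).sub hs) ?_ (fun x => by simp [hk0]) x)
    rw [dFun_sub (hks _) hs, dFun_const_smul r (hks ξ), ← hkd, ← hkd]
    exact sub_eq_zero.2 (generatorForm_smul Ω r (ξ : LieAlg m G))
  have hequiv : ∀ (a : G) (ξ η : EuclideanSpace ℝ (Fin m)), η = Ad (m := m) a ξ →
      ∀ x, k η (a • x) = k ξ x := by
    intro a ξ η hη x
    have hs := contMDiff_const_smul' m n (M := M) a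
    refine sub_eq_zero.1 (eq_zero_of_dFun_eq_zero_of_basepoint (n := n) hc
      (F := k η ∘ (fun x => a • x) - k ξ) (((hks _).comp hs).sub (hks ξ)) ?_ ?_ x)
    · rw [dFun_sub ((hks _).comp hs) (hks ξ), ← OneForm.pullback_dFun
        ((hks _).mdifferentiable (by simp)) (hs.mdifferentiable (by simp)), ← hkd, ← hkd, hη]
      exact sub_eq_zero.2 (pullback_generatorForm_Ad hinv a ξ)
    · intro y
      simp [hcfix y a, hk0]
  let μ : M → EuclideanSpace ℝ (Fin m) →L[ℝ] ℝ := fun x => LinearMap.toContinuousLinearMap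
    { toFun := fun ξ => k ξ x
      map_add' := fun ξ η => congrFun (hadd ξ η) x
      map_smul' := fun r ξ => congrFun (hsmul r ξ) x }
  have hμ : ∀ x ξ, μ x ξ = k ξ x := fun _ _ => rfl
  refine ⟨μ, ?_, ?_, ?_⟩
  -- By linearity `μ` is a fixed linear function of its finitely many components along a basis, each
  -- of which is smooth.
  · let B := EuclideanSpace.basisFun (Fin m) ℝ
    let T : (Fin m → ℝ) →L[ℝ] (EuclideanSpace ℝ (Fin m) →L[ℝ] ℝ) :=
      LinearMap.toContinuousLinearMap (Fintype.linearCombination ℝ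
        (fun i => (EuclideanSpace.proj i : EuclideanSpace ℝ (Fin m) →L[ℝ] ℝ)))
    have h1 : μ = T ∘ fun x i => k (B i) x := by
      funext x
      ext ξ
      have h2 : ξ = ∑ i, ξ i • B i := by
        simpa [B] using (B.sum_repr ξ).symm
      simp only [Function.comp_apply, T, LinearMap.coe_toContinuousLinearMap',
        Fintype.linearCombination_apply, sum_apply, smul_apply]
      conv_lhs => rw [h2]
      rw [map_sum]
      refine Finset.sum_congr rfl fun i _ => ?_
      rw [map_smul, hμ, smul_eq_mul, smul_eq_mul]
      exact mul_comm _ _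
    rw [h1]
    exact T.contDiff.contMDiff.comp (contMDiff_pi_space.2 fun i => hks (B i))
  · exact fun a x ξ => hequiv a ξ (Ad a ξ) rfl x
  · intro ξ x v
    rw [← generatorForm_apply]
    exact DFunLike.congr_fun (congrFun (hkd ξ) x) v

end MomentMap

end HamAct

theorem mainTheorem1 {m n : ℕ}
    {G : Type*} [TopologicalSpace G] [T2Space G] [ChartedSpace (EuclideanSpace ℝ (Fin m)) G]
    [Group G] [LieGroup (𝓡 m) ∞ G] [CompactSpace G] [ConnectedSpace G]
    {M : Type*} [TopologicalSpace M] [T2Space M] [SecondCountableTopology M]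
    [ChartedSpace (EuclideanSpace ℝ (Fin n)) M] [IsManifold (𝓡 n) ∞ M]
    [MeasurableSpace M] [BorelSpace M]
    [MulAction G M] [ContMDiffSMul (𝓡 m) (𝓡 n) ∞ G M]
    (Ω : HamAct.DiffForm n M 2) (g : HamAct.Metric n M) (J : HamAct.EndField n M)
    (hcomp : HamAct.IsCompatibleTriple Ω g J)
    (hinv : HamAct.IsInvariantTriple G Ω g J)
    (f : M → ℝ) (hf : ContMDiff (𝓡 n) 𝓘(ℝ, ℝ) ∞ f) (hf_nonneg : ∀ x, 0 ≤ f x)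
    (hf_bdd : ∃ C : ℝ, ∀ x, f x ≤ C)
    (lam : Measure M)
    (hlam : lam = (HamAct.riemannianMeasure g).withDensity fun x => ENNReal.ofReal (f x))
    (hlam_inv : ∀ a : G, MeasurePreserving (fun x : M => a • x) lam lam)
    (hgen : ∀ ξ : HamAct.LieAlg m G,
      HamAct.vectorFieldMemL2 g lam (fun x => HamAct.infGen ξ x))
    (hHodge : HamAct.HasHodgeDecomposition g lam)
    (hrep : HamAct.HasUniqueHarmonicRepresentatives g lam)
    (hJ : ∀ α : HamAct.OneForm n M, HamAct.IsL2Harmonic g lam α →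
      HamAct.IsL2Harmonic g lam (HamAct.OneForm.applyJ J α))
    (hfix : ∀ x : M, ∃ y ∈ connectedComponent x, ∀ a : G, a • y = y) :
    HamAct.IsHamiltonian m G Ω := by
  exact HamAct.isHamiltonian_of_exact hinv.form hfix fun ξ =>
    HamAct.generatorForm_exact hcomp hinv hlam_inv hHodge hrep hJ hfix (hgen ξ)
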